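/- Let $M$ be a complex manifold with $\dim_{\mathbb C} M = 2n$ and holomorphic tangent bundle $TM$. A \emph{holomorphic $SL(2)$-web} on $M$ is a family $S_t\subset TM$, $t\in\mathbb{CP}^1$, of holomorphic sub-bundles of rank $n$ such that (i) each $S_t$ is involutive, $[S_t,S_t]\subset S_t$; (ii) $S_t\cap S_{t'}=0$ for $t\neq t'$; (iii) if $P_{t,t'}\in \mathrm{End}(TM)$, $t\ne t'$, denotes the projection onto $S_t$ along $S_{t'}$, then the traceless parts $P_{t,t'}-\tfrac12\mathbf 1$ span a sub-bundle of rank $3$ in $\mathrm{End}(TM)$. A \emph{Chern connection} of the web is a torsion-free holomorphic connection $\nabla$ on $TM$ which preserves $S_t$ for all $t\in\mathbb{CP}^1$. A \emph{trisymplectic structure generating the web} is a $3$-dimensional complex vector space $\boldsymbol\Omega$ of closed holomorphic $2$-forms on $M$ such that for each $t\in\mathbb{CP}^1$ there is $\Omega_t\in\boldsymbol\Omega$ with $S_t=\{v\in TM : \Omega_t(v,\cdot)=0\}$. Theorem. Let $(S_t)_{t\in\mathbb{CP}^1}$ be a holomorphic $SL(2)$-web on $M$, and let $\boldsymbol\Omega$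 be a trisymplectic structure generating it. Then the web has a Chern connection, and every Chern connection $\nabla$ of the web satisfies $\nabla\Omega=0$ for each $\Omega\in\boldsymbol\Omega$. -/

import Mathlib

open Bundle Module
open scoped Manifold ContDiff Topology

noncomputable section

namespace SL2Web

/-! Throughout, `M` is a complex manifold modelled on a finite-dimensional complex vector space `E`,
and `TangentSpace 𝓘(ℂ, E) x` is its holomorphic tangent space at `x`. "Holomorphic" is rendered as
complex analytic, i.e. `C^ω` over `ℂ`. -/

variable {E : Type*} [NormedAddCommGroup E] [NormedSpace ℂ E]
  {M : Type*} [TopologicalSpace M] [ChartedSpace E M]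

/-! ### Vector fields and distributions -/

variable (E M) in
/-- Vector fields on `M`, with no regularity imposed. -/
abbrev VField : Type _ := Π x : M, TangentSpace 𝓘(ℂ, E) x

variable (E M) in
/-- Distributions on `M`: families of complex subspaces of the tangent spaces. -/
abbrev Distribution : Type _ := Π x : M, Submodule ℂ (TangentSpace 𝓘(ℂ, E) x)

/-- The vector field `X` is holomorphic on `U`. -/
def HolomorphicOn [IsManifold 𝓘(ℂ, E) ω M] (X : VField E M) (U : Set M) : Prop :=
  ContMDiffOn 𝓘(ℂ, E) (𝓘(ℂ, E).prod 𝓘(ℂ, E)) ω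
    (fun x ↦ (⟨x, X x⟩ : TotalSpace E (TangentSpace 𝓘(ℂ, E) : M → Type _))) U

/-- `D` is a holomorphic sub-bundle of `TM` of rank `n`: it has a holomorphic frame with `n`
members near each point. -/
def IsHolomorphicSubbundle [IsManifold 𝓘(ℂ, E) ω M] (n : ℕ) (D : Distribution E M) : Prop :=
  ∀ x₀ : M, ∃ U : Set M, IsOpen U ∧ x₀ ∈ U ∧ ∃ s : Fin n → VField E M,
    (∀ i, HolomorphicOn (s i) U) ∧
    ∀ x ∈ U, LinearIndependent ℂ (fun i ↦ s i x) ∧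
      Submodule.span ℂ (Set.range fun i ↦ s i x) = D x

/-- `[D, D] ⊆ D`, for local holomorphic sections of `D`. -/
def IsInvolutive [IsManifold 𝓘(ℂ, E) ω M] (D : Distribution E M) : Prop :=
  ∀ U : Set M, IsOpen U → ∀ X Y : VField E M, HolomorphicOn X U → HolomorphicOn Y U →
    (∀ x ∈ U, X x ∈ D x) → (∀ x ∈ U, Y x ∈ D x) →
    ∀ x ∈ U, VectorField.mlieBracket 𝓘(ℂ, E) X Y x ∈ D x

/-! ### Holomorphic `SL(2)`-webs -/

/-- The complex projective line. -/
abbrev CP1 : Type := Projectivization ℂ (Fin 2 → ℂ)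

/-- For a family `V t` of subspaces of a vector space `T`, the subspace of `End(T)` spanned by the
traceless parts `P - (1/2) • 1` of the projections `P` of `T` onto `V t` along `V t'`, over all pairs
`t ≠ t'` for which `V t` and `V t'` are complementary (in a web these are all pairs `t ≠ t'`, and
each `V t` has dimension `(1/2) dim T`, so that `P` has trace `(1/2) dim T`). -/
def projectionSpan {T : Type*} [AddCommGroup T] [Module ℂ T] (V : CP1 → Submodule ℂ T) :
    Submodule ℂ (T →ₗ[ℂ] T) :=
  Submodule.span ℂ {A | ∃ t t' : CP1, t ≠ t' ∧ ∃ h : IsCompl (V t) (V t'),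
    A = (V t).projection (V t') h - (1 / 2 : ℂ) • LinearMap.id}

/-- A holomorphic `SL(2)`-web on a complex manifold of dimension `2n`: a family of involutive
holomorphic sub-bundles `S t` of `TM` of rank `n`, `t ∈ ℂP¹`, pairwise transversal, such that the
traceless parts of the projections onto `S t` along `S t'` span a sub-bundle of `End(TM)` of
rank 3. -/
structure IsSL2Web [IsManifold 𝓘(ℂ, E) ω M] (n : ℕ) (S : CP1 → Distribution E M) : Prop where
  dim_eq : finrank ℂ E = 2 * n
  subbundle : ∀ t, IsHolomorphicSubbundle n (S t)
  involutive : ∀ t, IsInvolutive (S t)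
  transversal : ∀ t t', t ≠ t' → ∀ x, S t x ⊓ S t' x = ⊥
  rank_projections : ∀ x, finrank ℂ (projectionSpan fun t ↦ S t x) = 3

/-! ### Holomorphic connections -/

/-- A connection on `TM` is holomorphic if it sends holomorphic sections of `TM` over any open set
to holomorphic sections of `Hom(TM, TM)` over that set. -/
def IsHolomorphicConnection [IsManifold 𝓘(ℂ, E) ω M]
    (cov : CovariantDerivative 𝓘(ℂ, E) E (TangentSpace 𝓘(ℂ, E) : M → Type _)) : Prop :=
  ∀ U : Set M, IsOpen U → ContMDiffCovariantDerivativeOn E ω cov.toFun U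

/-- The connection preserves `D`: it maps local holomorphic sections of `D` to `D ⊗ Ω¹M`. -/
def Preserves [IsManifold 𝓘(ℂ, E) ω M]
    (cov : CovariantDerivative 𝓘(ℂ, E) E (TangentSpace 𝓘(ℂ, E) : M → Type _))
    (D : Distribution E M) : Prop :=
  ∀ U : Set M, IsOpen U → ∀ X : VField E M, HolomorphicOn X U → (∀ x ∈ U, X x ∈ D x) →
    ∀ x ∈ U, ∀ v : TangentSpace 𝓘(ℂ, E) x, cov X x v ∈ D x

/-- A Chern connection of the web `S`: a torsion-free holomorphic connection on `TM` preserving all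
the sub-bundles `S t`. -/
structure IsChernConnection [FiniteDimensional ℂ E] [CompleteSpace E] [IsManifold 𝓘(ℂ, E) ω M]
    (S : CP1 → Distribution E M)
    (cov : CovariantDerivative 𝓘(ℂ, E) E (TangentSpace 𝓘(ℂ, E) : M → Type _)) : Prop where
  holomorphic : IsHolomorphicConnection cov
  torsion_free : cov.torsion = 0
  preserves : ∀ t, Preserves cov (S t)

/-! ### Differential 2-forms -/

variable (E M) in
/-- `(2,0)`-forms on `M`: families of complex-bilinear alternating forms on the tangent spaces, with
no regularity imposed. -/
abbrev TwoForm : Type _ := Π x : M, TangentSpace 𝓘(ℂ, E) x [⋀^Fin 2]→L[ℂ] ℂ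

/-- The expression of a 2-form in the preferred chart at `x₀`: its pull-back to (the target of that
chart in) `E` by the inverse of the chart. -/
def TwoForm.inChart (η : TwoForm E M) (x₀ : M) : E → E [⋀^Fin 2]→L[ℂ] ℂ := fun y ↦
  (η ((extChartAt 𝓘(ℂ, E) x₀).symm y)).compContinuousLinearMap
    (mfderiv 𝓘(ℂ, E) 𝓘(ℂ, E) (extChartAt 𝓘(ℂ, E) x₀).symm y)

/-- The 2-form is holomorphic, i.e. it is so in charts. -/
def TwoForm.IsHolomorphic (η : TwoForm E M) : Prop :=
  ∀ x₀ : M, ContDiffOn ℂ ω (TwoForm.inChart η x₀) (extChartAt 𝓘(ℂ, E) x₀).target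

/-- The 2-form is closed: its exterior derivative, computed in charts, vanishes. -/
def TwoForm.IsClosed (η : TwoForm E M) : Prop :=
  ∀ x₀ : M, ∀ y ∈ (extChartAt 𝓘(ℂ, E) x₀).target, extDeriv (TwoForm.inChart η x₀) y = 0

/-- The null-space (annihilator) of a 2-form: all `v` with `η(v, ·) = 0`. -/
def TwoForm.null (η : TwoForm E M) : Distribution E M := fun x ↦
  { carrier := {v | ∀ w : TangentSpace 𝓘(ℂ, E) x, η x ![v, w] = 0}
    add_mem' := by
      intro a b ha hb w
      have h := (η x).toMultilinearMap.cons_add ![w] a b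
      exact h.trans (by
        rw [show (η x).toMultilinearMap (Fin.cons a ![w]) = 0 from ha w,
          show (η x).toMultilinearMap (Fin.cons b ![w]) = 0 from hb w, add_zero])
    zero_mem' := fun w ↦ (η x).map_coord_zero 0 rfl
    smul_mem' := by
      intro c a ha w
      have h := (η x).toMultilinearMap.cons_smul ![w] c a
      exact h.trans (by
        rw [show (η x).toMultilinearMap (Fin.cons a ![w]) = 0 from ha w, smul_zero]) }

/-- `Ω` is a trisymplectic structure generating the web `S`: a 3-dimensional complex vector space of
closed holomorphic 2-forms such that each `S t` is the null-space of a member of `Ω`. -/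
structure GeneratesWeb (Ω : Submodule ℂ (TwoForm E M)) (S : CP1 → Distribution E M) : Prop where
  finrank_eq : finrank ℂ Ω = 3
  holomorphic : ∀ η ∈ Ω, TwoForm.IsHolomorphic η
  closed : ∀ η ∈ Ω, TwoForm.IsClosed η
  generates : ∀ t, ∃ η ∈ Ω, S t = TwoForm.null η

/-- The covariant derivative of a 2-form, evaluated at `x` on a tangent vector `v` and on two vector
fields: `(∇_v η)(Y, Z) = v(η(Y, Z)) - η(∇_v Y, Z) - η(Y, ∇_v Z)`. -/
def covDeriv [IsManifold 𝓘(ℂ, E) ω M]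
    (cov : CovariantDerivative 𝓘(ℂ, E) E (TangentSpace 𝓘(ℂ, E) : M → Type _))
    (η : TwoForm E M) (Y Z : VField E M) (x : M) (v : TangentSpace 𝓘(ℂ, E) x) : ℂ :=
  mvfderiv 𝓘(ℂ, E) (fun y ↦ η y ![Y y, Z y]) x v
    - η x ![cov Y x v, Z x] - η x ![Y x, cov Z x v]

/-- `∇η = 0`. -/
def IsParallel [IsManifold 𝓘(ℂ, E) ω M]
    (cov : CovariantDerivative 𝓘(ℂ, E) E (TangentSpace 𝓘(ℂ, E) : M → Type _))
    (η : TwoForm E M) : Prop :=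
  ∀ U : Set M, IsOpen U → ∀ Y Z : VField E M, HolomorphicOn Y U → HolomorphicOn Z U →
    ∀ x ∈ U, ∀ v : TangentSpace 𝓘(ℂ, E) x, covDeriv cov η Y Z x v = 0

end SL2Web

end

open Bundle Module
open scoped Manifold ContDiff Topology

noncomputable section

namespace SL2Web

/-! ### Linear algebra of families of skew forms with prescribed null-spaces -/

section LinearAlgebra

variable {ι T : Type*} [AddCommGroup T] [Module ℂ T]

/-! Existence. Fix three members `S z`, `S o`, `S i` of the web. They give a splitting TM = S z ⊕ S
i and a holomorphic involution J swapping the summands, with S o the graph of J on S z. The crucial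
point is that every other S t, except S i, is the graph of l • J with l a constant on M
(`GeneratesWeb.exists_add_smul_mem`). This comes from Ω: forms with three distinct null-spaces form
a basis, so each further form satisfies a linear relation with constant coefficients. Two such
relations force the forms of `o` and `z` to be proportional on S i, with a constant factor, and this
factor fixes all slopes. The rank 3 condition enters only through n ≠ 0.

The connection is written down from Lie brackets, P, Q and J (`IsSplitting.connection`). It
preserves each graph because a constant slope passes through brackets (`IsSplitting.Q_connection`).
For torsion, involutivity of the graphs of m • J for two distinct nonzero constants m, together with
that of S z and S i, separates a polynomial identity in m into the two relations required
(`IsSL2Web.bracket_relations`, `IsSplitting.torsion_eq_zero`).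

Parallelism. If ∇ is torsion-free and η is closed, the cyclic sum of ∇η vanishes
(`covTensor_cyclic`); if ∇ preserves the null-space of η, that null-space also annihilates ∇η
(`covTensor_eq_zero_of_mem_null`). Hence ∇_u η = 0 whenever u is in the null-space of η. For u in S
z this kills the first term of η_p = a η_z + b η_o + c η_i. The derivatives of η_o and η_i along u
then have a combination annihilated by S p, and `apply_eq_zero_of_add` makes both vanish. Thus ∇_u
kills Ω for u in S z, and two different members of the web span TM. -/

/-- A family of pairwise complementary nonzero subspaces `V t`, each of which is the null-space of
a skew form `B t`. -/
structure IsNullFamily (V : ι → Submodule ℂ T) (B : ι → T →ₗ[ℂ] T →ₗ[ℂ] ℂ) : Prop where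
  isCompl : ∀ ⦃t t'⦄, t ≠ t' → IsCompl (V t) (V t')
  skew : ∀ t v w, B t v w = -B t w v
  mem_iff : ∀ t v, v ∈ V t ↔ ∀ w, B t v w = 0
  ne_bot : ∀ t, V t ≠ ⊥

namespace IsNullFamily

variable {V : ι → Submodule ℂ T} {B : ι → T →ₗ[ℂ] T →ₗ[ℂ] ℂ} (h : IsNullFamily V B)
include h

lemma eq_zero_of_mem {t t' : ι} (htt' : t ≠ t') {v : T} (hv : v ∈ V t) (hv' : v ∈ V t') :
    v = 0 :=
  Submodule.disjoint_def.1 (h.isCompl htt').disjoint v hv hv'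

lemma apply_eq_zero_right {t : ι} {w : T} (hw : w ∈ V t) (v : T) : B t v w = 0 := by
  rw [h.skew, (h.mem_iff t w).1 hw v, neg_zero]

lemma exists_add {t t' : ι} (htt' : t ≠ t') (v : T) : ∃ a ∈ V t, ∃ b ∈ V t', a + b = v :=
  Submodule.codisjoint_iff_exists_add_eq.1 (h.isCompl htt').codisjoint v |>.imp
    fun _ ⟨b, ha, hb, e⟩ ↦ ⟨ha, b, hb, e⟩

/-- A functional `B t u` vanishes on `V t` anyway, so a complement is all that needs testing. -/
lemma mem_of_forall_mem {t t' : ι} (htt' : t ≠ t') {u : T}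
    (hu : ∀ w ∈ V t', B t u w = 0) : u ∈ V t := by
  rw [h.mem_iff]
  intro w
  obtain ⟨a, ha, b, hb, rfl⟩ := h.exists_add htt' w
  rw [map_add, h.apply_eq_zero_right ha, hu b hb, add_zero]

/-- The common functional kills both `V t` and `V t'`, hence everything. This is how linear
relations among the forms become membership statements. -/
lemma mem_of_apply_eq {t t' : ι} (htt' : t ≠ t') {u v : T} (huv : ∀ w, B t u w = B t' v w) :
    u ∈ V t :=
  h.mem_of_forall_mem htt' fun w hw ↦ by rw [huv, h.apply_eq_zero_right hw]

lemma exists_ne_zero (t : ι) : ∃ v ∈ V t, v ≠ 0 := Submodule.exists_mem_ne_zero_of_ne_bot (h.ne_bot t)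

/-- A combination of two of the forms which vanishes on a third subspace is zero. -/
lemma coeff_eq_zero {t t' r : ι} (htt' : t ≠ t') (htr : t ≠ r) {a c : ℂ}
    (hac : ∀ s ∈ V r, ∀ w, a * B t s w + c * B t' s w = 0) : a = 0 := by
  obtain ⟨s, hs, hs0⟩ := h.exists_ne_zero r
  by_contra ha
  refine hs0 (h.eq_zero_of_mem htr ?_ hs)
  -- The relation says that `B t` of `a • s` equals `B t'` of `-c • s`.
  have : a • s ∈ V t := h.mem_of_apply_eq htt' (v := -c • s) fun w ↦ by
    have := hac s hs w
    simp only [map_smul, LinearMap.smul_apply, smul_eq_mul]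
    linear_combination this
  exact (Submodule.smul_mem_iff _ ha).1 this

/-- Decompose `d` along `V p ⊕ V o` and take minus the first component; the relation on `V p` then
trades `B o` for `B z` and `B i`. -/
lemma exists_mem_add_mem {z o i p : ι} (hpo : p ≠ o) {a c : ℂ}
    (hp : ∀ s ∈ V p, ∀ w, a * B z s w + B o s w + c * B i s w = 0) (d : T) :
    ∃ s ∈ V p, s + d ∈ V o ∧ ∀ w, a * B z s w + c * B i s w = B o d w := by
  obtain ⟨s, hs, r, hr, hsr⟩ := h.exists_add hpo d
  refine ⟨-s, neg_mem hs, by rwa [← hsr, neg_add_cancel_left], fun w ↦ ?_⟩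
  have h1 := hp s hs w
  have h2 := (h.mem_iff o r).1 hr w
  rw [← hsr]
  simp only [map_add, map_neg, LinearMap.add_apply, LinearMap.neg_apply]
  linear_combination -h1 - h2

/-- Let `s` in `V p` and `r` in `V q` be the vectors attached to the same `d`. Subtracting their
relations puts `a • s - a' • r` in `V z` and `c' • r - c • s` in `V i`. As `V o` and `V i` meet
trivially, `c' • (r + d) = c • (s + d)`; eliminating `r` leaves a vector of `V z` built from `s` and
`d` only. -/
lemma exists_smul_add_smul_mem {z o i p q : ι} (hzi : z ≠ i) (hoi : o ≠ i)
    (hpo : p ≠ o) (hqo : q ≠ o) {a c a' c' : ℂ}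
    (hp : ∀ s ∈ V p, ∀ w, a * B z s w + B o s w + c * B i s w = 0)
    (hq : ∀ s ∈ V q, ∀ w, a' * B z s w + B o s w + c' * B i s w = 0)
    {d : T} (hd : d ∈ V i) :
    ∃ s ∈ V p, s + d ∈ V o ∧ (∀ w, a * B z s w + c * B i s w = B o d w) ∧
      (a * c' - a' * c) • s + (a' * (c' - c)) • d ∈ V z := by
  obtain ⟨s, hs, hso, hsd⟩ := h.exists_mem_add_mem hpo hp d
  obtain ⟨r, hr, hro, hrd⟩ := h.exists_mem_add_mem hqo hq d
  have hz : a • s - a' • r ∈ V z := h.mem_of_apply_eq hzi (v := c' • r - c • s) fun w ↦ by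
    simp only [map_sub, map_smul, LinearMap.sub_apply, LinearMap.smul_apply, smul_eq_mul]
    linear_combination hsd w - hrd w
  have hi : c' • r - c • s ∈ V i := h.mem_of_apply_eq hzi.symm (v := a • s - a' • r) fun w ↦ by
    simp only [map_sub, map_smul, LinearMap.sub_apply, LinearMap.smul_apply, smul_eq_mul]
    linear_combination hrd w - hsd w
  have h0 : c' • (r + d) - c • (s + d) = 0 := by
    refine h.eq_zero_of_mem hoi ?_ ?_
    · exact sub_mem (Submodule.smul_mem _ _ hro) (Submodule.smul_mem _ _ hso)
    · have : c' • (r + d) - c • (s + d) = (c' • r - c • s) + (c' - c) • d := by module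
      rw [this]
      exact add_mem hi (Submodule.smul_mem _ _ hd)
  refine ⟨s, hs, hso, hsd, ?_⟩
  have : (a * c' - a' * c) • s + (a' * (c' - c)) • d =
      c' • (a • s - a' • r) + a' • (c' • (r + d) - c • (s + d)) := by module
  rw [this, h0, smul_zero, add_zero]
  exact Submodule.smul_mem _ _ hz

/-- If the determinant vanished, the preceding elimination would put a multiple of a nonzero `d` of
`V i` in `V z`. So `c = c'`, then `a = a'`, and the two relations coincide, making `V p` part of `V
q`. -/
lemma det_ne_zero {z o i p q : ι} (hzi : z ≠ i) (hoi : o ≠ i)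
    (hpo : p ≠ o) (hqo : q ≠ o) (hpq : p ≠ q) {a c a' c' e : ℂ} (hc' : c' ≠ 0) (ha' : a' ≠ 0)
    (hp : ∀ s ∈ V p, ∀ w, a * B z s w + B o s w + c * B i s w = 0)
    (hq : ∀ s ∈ V q, ∀ w, a' * B z s w + B o s w + c' * B i s w = 0)
    (he : ∀ s w, B q s w = e * (a' * B z s w + B o s w + c' * B i s w)) :
    a * c' - a' * c ≠ 0 := by
  intro h0
  obtain ⟨d, hd, hd0⟩ := h.exists_ne_zero i
  obtain ⟨s, hs, hso, hsd, hz⟩ := h.exists_smul_add_smul_mem hzi hoi hpo hqo hp hq hd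
  rw [h0, zero_smul, zero_add] at hz
  by_cases hcc : c' - c = 0
  · obtain rfl : c' = c := sub_eq_zero.1 hcc
    have haa : a = a' := by
      have : (a - a') * c' = 0 := by linear_combination h0
      rcases mul_eq_zero.1 this with h1 | h1
      · exact sub_eq_zero.1 h1
      · exact absurd h1 hc'
    subst haa
    obtain ⟨v, hv, hv0⟩ := h.exists_ne_zero p
    refine hv0 (h.eq_zero_of_mem hpq hv ((h.mem_iff q v).2 fun w ↦ ?_))
    rw [he, hp v hv w, mul_zero]
  · exact hd0 (h.eq_zero_of_mem hzi ((Submodule.smul_mem_iff _ (mul_ne_zero ha' hcc)).1 hz) hd)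

/-- The restrictions of `B o` and `B z` to `V i` are proportional, with a factor depending only on
the coefficients of two linear relations. -/
lemma apply_eq_mul_apply {z o i p q : ι} (hzi : z ≠ i) (hoi : o ≠ i)
    (hpo : p ≠ o) (hqo : q ≠ o) {a c a' c' : ℂ} (hdet : a * c' - a' * c ≠ 0)
    (hp : ∀ s ∈ V p, ∀ w, a * B z s w + B o s w + c * B i s w = 0)
    (hq : ∀ s ∈ V q, ∀ w, a' * B z s w + B o s w + c' * B i s w = 0)
    {d w : T} (hd : d ∈ V i) (hw : w ∈ V i) :
    B o d w = -(a * a' * (c' - c) / (a * c' - a' * c)) * B z d w := by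
  -- Pairing with `w` in `V i` removes `B i`. There remain `B o d w = a * B z s w` and one linear
  -- equation between `B z s w` and `B z d w`.
  obtain ⟨s, hs, hso, hsd, hz⟩ := h.exists_smul_add_smul_mem hzi hoi hpo hqo hp hq hd
  have h1 := (h.mem_iff z _).1 hz w
  simp only [map_add, map_smul, LinearMap.add_apply, LinearMap.smul_apply, smul_eq_mul] at h1
  have h2 := hsd w
  rw [h.apply_eq_zero_right hw, mul_zero, add_zero] at h2
  rw [← h2]
  field_simp
  linear_combination a * h1

/-- If `B o = k • B z` on `V i`, then `V t` is, in the decomposition `V z ⊕ V i`, a constant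
multiple of the graph `V o`. -/
lemma add_smul_mem {z o i t : ι} (hzi : z ≠ i) (hoz : o ≠ z)
    (hto : t ≠ o) (hti : t ≠ i) {a c k : ℂ} (ha : a ≠ 0)
    (ht : ∀ s ∈ V t, ∀ w, a * B z s w + B o s w + c * B i s w = 0)
    (hk : ∀ d ∈ V i, ∀ w ∈ V i, B o d w = k * B z d w) {u v : T} (hu : u ∈ V z) (hv : v ∈ V i)
    (huv : u + v ∈ V o) : u + (k / a / (k / a + 1)) • v ∈ V t := by
  -- On `V i` the functionals of `a • s` and `k • d` under `B z` agree, so `s - (k / a) • d` lies in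
  -- `V z`. The same vector `x` thus describes a point of `V t` and a point of `V o`, and the ratio
  -- of their `V i` components is the slope.
  have key (d : T) (hd : d ∈ V i) : ∃ x ∈ V z, x + (k / a) • d ∈ V t ∧
      x + (k / a + 1) • d ∈ V o := by
    obtain ⟨s, hs, hso, hsd⟩ := h.exists_mem_add_mem hto ht d
    refine ⟨s - (k / a) • d, h.mem_of_forall_mem hzi fun w hw ↦ ?_, by simpa using hs, ?_⟩
    · have := hsd w
      rw [h.apply_eq_zero_right hw, hk d hd w hw] at this
      simp only [map_sub, map_smul, LinearMap.sub_apply, LinearMap.smul_apply, smul_eq_mul]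
      field_simp
      linear_combination this
    · convert hso using 1
      module
  have hne : k / a + 1 ≠ 0 := by
    intro h0
    obtain ⟨d, hd, hd0⟩ := h.exists_ne_zero i
    obtain ⟨x, hx, hxt, hxo⟩ := key d hd
    rw [h0, zero_smul, add_zero] at hxo
    rw [h.eq_zero_of_mem hoz hxo hx, zero_add, eq_neg_of_add_eq_zero_left h0, neg_smul,
      one_smul] at hxt
    exact hd0 (h.eq_zero_of_mem hti (neg_mem_iff.1 hxt) hd)
  -- The rescaling makes the `V i` component of the point of `V o` equal to `v`; transversality then
  -- forces `x = u`.
  obtain ⟨x, hx, hxt, hxo⟩ := key ((k / a + 1)⁻¹ • v) (Submodule.smul_mem _ _ hv)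
  rw [smul_smul, mul_inv_cancel₀ hne, one_smul] at hxo
  have hxu : x = u := by
    have : x - u = 0 := h.eq_zero_of_mem hoz
      (by simpa using sub_mem hxo huv) (sub_mem hx hu)
    exact sub_eq_zero.1 this
  rw [smul_smul, ← div_eq_mul_inv] at hxt
  exact hxu ▸ hxt

end IsNullFamily

/-- Two skew forms whose null-spaces contain members of a triple of pairwise complementary
subspaces, and whose sum vanishes on the third, are zero. -/
lemma apply_eq_zero_of_add {S₁ S₂ S₃ : Submodule ℂ T} (h₁₂ : IsCompl S₁ S₂) (h₂₃ : IsCompl S₂ S₃)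
    {β₁ β₂ : T → T → ℂ} (hadd : ∀ u v w, β₂ (u + v) w = β₂ u w + β₂ v w)
    (hadd' : ∀ u v w, β₂ u (v + w) = β₂ u v + β₂ u w)
    (h₁' : ∀ v, ∀ s ∈ S₁, β₁ v s = 0)
    (h₂ : ∀ s ∈ S₂, ∀ w, β₂ s w = 0) (h₂' : ∀ v, ∀ s ∈ S₂, β₂ v s = 0)
    (h₃ : ∀ s ∈ S₃, ∀ w, β₁ s w + β₂ s w = 0) (v w : T) : β₂ v w = 0 := by
  -- Since `β₂` kills `S₂` in both slots, only its values on `S₃ × S₁` matter; there `β₁` vanishes,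
  -- hence so does `β₂`.
  obtain ⟨b, c, hb, hc, rfl⟩ := Submodule.codisjoint_iff_exists_add_eq.1 h₂₃.codisjoint v
  obtain ⟨x, y, hx, hy, rfl⟩ := Submodule.codisjoint_iff_exists_add_eq.1 h₁₂.codisjoint w
  have h := h₃ c hc x
  rw [h₁' c x hx, zero_add] at h
  rw [hadd, h₂ b hb, zero_add, hadd', h, h₂' c y hy, add_zero]

end LinearAlgebra

/-! ### The constants of a web generated by a trisymplectic structure -/

section Constants

lemma _root_.Submodule.exists_eq_of_finrank_eq_three {W : Type*} [AddCommGroup W] [Module ℂ W]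
    {Ω : Submodule ℂ W} (h : finrank ℂ Ω = 3) {u v w : W} (hu : u ∈ Ω) (hv : v ∈ Ω) (hw : w ∈ Ω)
    (hind : ∀ a b c : ℂ, a • u + b • v + c • w = 0 → a = 0 ∧ b = 0 ∧ c = 0) {y : W} (hy : y ∈ Ω) :
    ∃ a b c : ℂ, y = a • u + b • v + c • w := by
  let f : Fin 3 → Ω := ![⟨u, hu⟩, ⟨v, hv⟩, ⟨w, hw⟩]
  have hf : LinearIndependent ℂ f := by
    rw [Fintype.linearIndependent_iff]
    intro g hg
    obtain ⟨h0, h1, h2⟩ := hind (g 0) (g 1) (g 2) (by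
      simpa [Fin.sum_univ_three, f] using congrArg Subtype.val hg)
    intro j
    fin_cases j
    exacts [h0, h1, h2]
  have hspan : Submodule.span ℂ (Set.range f) = ⊤ :=
    hf.span_eq_top_of_card_eq_finrank (by rw [h]; rfl)
  have hmem : (⟨y, hy⟩ : Ω) ∈ Submodule.span ℂ (Set.range f) := hspan ▸ Submodule.mem_top
  obtain ⟨g, hg⟩ := (Submodule.mem_span_range_iff_exists_fun ℂ).1 hmem
  exact ⟨g 0, g 1, g 2, by simpa [Fin.sum_univ_three, f] using (congrArg Subtype.val hg).symm⟩

variable {E : Type*} [NormedAddCommGroup E] [NormedSpace ℂ E]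
  {M : Type*} [TopologicalSpace M] [ChartedSpace E M]

/-! ### Two-forms at a point as skew bilinear forms -/

namespace TwoForm

variable (η : TwoForm E M) (x : M)

lemma swap (v w : TangentSpace 𝓘(ℂ, E) x) : η x ![v, w] = -η x ![w, v] := by
  have := (η x).toAlternatingMap.map_swap ![w, v] (i := 0) (j := 1) (by decide)
  rw [show ![w, v] ∘ Equiv.swap (0 : Fin 2) 1 = ![v, w] by ext i; fin_cases i <;> rfl] at this
  exact this

lemma apply_add_left (u v w : TangentSpace 𝓘(ℂ, E) x) :
    η x ![u + v, w] = η x ![u, w] + η x ![v, w] :=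
  (η x).toMultilinearMap.cons_add ![w] u v

lemma apply_smul_left (c : ℂ) (v w : TangentSpace 𝓘(ℂ, E) x) :
    η x ![c • v, w] = c * η x ![v, w] :=
  (η x).toMultilinearMap.cons_smul ![w] c v

lemma apply_add_right (u v w : TangentSpace 𝓘(ℂ, E) x) :
    η x ![u, v + w] = η x ![u, v] + η x ![u, w] := by
  rw [swap, apply_add_left, swap η x u v, swap η x u w, neg_add]

lemma apply_smul_right (c : ℂ) (v w : TangentSpace 𝓘(ℂ, E) x) :
    η x ![v, c • w] = c * η x ![v, w] := by
  rw [swap, apply_smul_left, swap η x v w, mul_neg]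

/-- A 2-form at a point, as a bilinear map. -/
def bilin : TangentSpace 𝓘(ℂ, E) x →ₗ[ℂ] TangentSpace 𝓘(ℂ, E) x →ₗ[ℂ] ℂ :=
  LinearMap.mk₂ ℂ (fun v w ↦ η x ![v, w]) (apply_add_left η x) (apply_smul_left η x)
    (apply_add_right η x) (apply_smul_right η x)

@[simp] lemma bilin_apply (v w : TangentSpace 𝓘(ℂ, E) x) : bilin η x v w = η x ![v, w] := rfl

end TwoForm

variable [IsManifold 𝓘(ℂ, E) ω M]

lemma IsHolomorphicSubbundle.finrank_eq {n : ℕ} {D : Distribution E M}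
    (hD : IsHolomorphicSubbundle n D) (x : M) : finrank ℂ (D x) = n := by
  obtain ⟨U, -, hxU, s, -, hs⟩ := hD x
  rw [← (hs x hxU).2, finrank_span_eq_card (hs x hxU).1, Fintype.card_fin]

instance (x : M) [FiniteDimensional ℂ E] : FiniteDimensional ℂ (TangentSpace 𝓘(ℂ, E) x) :=
  inferInstanceAs (FiniteDimensional ℂ E)

variable [FiniteDimensional ℂ E] {n : ℕ} {S : CP1 → Distribution E M}

omit [FiniteDimensional ℂ E] in
lemma IsSL2Web.finrank_tangentSpace (hS : IsSL2Web n S) (x : M) :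
    finrank ℂ (TangentSpace 𝓘(ℂ, E) x) = 2 * n := hS.dim_eq

lemma IsSL2Web.isCompl (hS : IsSL2Web n S) {t t' : CP1} (h : t ≠ t') (x : M) :
    IsCompl (S t x) (S t' x) := by
  have hd : Disjoint (S t x) (S t' x) := disjoint_iff.2 (hS.transversal t t' h x)
  refine ⟨hd, codisjoint_iff.2 (Submodule.eq_top_of_disjoint _ _ ?_ hd)⟩
  rw [(hS.subbundle t).finrank_eq, (hS.subbundle t').finrank_eq, hS.finrank_tangentSpace, two_mul]

/-- For `n = 0` the endomorphism space is zero and cannot contain a subspace of dimension 3. -/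
lemma IsSL2Web.ne_bot (hS : IsSL2Web n S) (t : CP1) (x : M) : S t x ≠ ⊥ := by
  intro h
  have hn : n = 0 := by
    rw [← (hS.subbundle t).finrank_eq x, h, finrank_bot]
  have h3 := hS.rank_projections x
  have hle := Submodule.finrank_le (projectionSpan fun t ↦ S t x)
  rw [h3, finrank_linearMap, hS.finrank_tangentSpace, hn] at hle
  omega

lemma IsSL2Web.isNullFamily (hS : IsSL2Web n S) {η : CP1 → TwoForm E M}
    (hη : ∀ t, S t = TwoForm.null (η t)) (x : M) :
    IsNullFamily (fun t ↦ S t x) (fun t ↦ TwoForm.bilin (η t) x) where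
  isCompl _ _ h := hS.isCompl h x
  skew t v w := TwoForm.swap (η t) x v w
  mem_iff t v := by rw [hη t]; rfl
  ne_bot t := hS.ne_bot t x

-- On an empty manifold every space of forms is zero. A base point lets identities between constant
-- coefficients be checked at a single tangent space.
omit [IsManifold 𝓘(ℂ, E) ω M] [FiniteDimensional ℂ E] in
lemma GeneratesWeb.nonempty {Ω : Submodule ℂ (TwoForm E M)} (hΩ : GeneratesWeb Ω S) :
    Nonempty M := by
  by_contra hM
  rw [not_nonempty_iff] at hM
  have : Subsingleton Ω := ⟨fun a b ↦ Subtype.ext (funext fun x ↦ hM.elim x)⟩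
  have h := hΩ.finrank_eq
  rw [finrank_zero_of_subsingleton] at h
  omega

/-- Forms in `Ω` with three distinct null-spaces span `Ω`. -/
lemma GeneratesWeb.exists_eq (hS : IsSL2Web n S) {Ω : Submodule ℂ (TwoForm E M)}
    (hΩ : GeneratesWeb Ω S) {η : CP1 → TwoForm E M} (hηΩ : ∀ t, η t ∈ Ω)
    (hη : ∀ t, S t = TwoForm.null (η t)) {z o i : CP1} (hzo : z ≠ o) (hzi : z ≠ i) (hoi : o ≠ i)
    {θ : TwoForm E M} (hθ : θ ∈ Ω) :
    ∃ a b c : ℂ, θ = a • η z + b • η o + c • η i := by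
  obtain ⟨x⟩ := hΩ.nonempty
  have hN := hS.isNullFamily hη x
  refine Submodule.exists_eq_of_finrank_eq_three (W := TwoForm E M) hΩ.finrank_eq (hηΩ z) (hηΩ o)
    (hηΩ i) (fun a b c habc ↦ ?_) hθ
  have hg (v w : TangentSpace 𝓘(ℂ, E) x) : a * TwoForm.bilin (η z) x v w +
      b * TwoForm.bilin (η o) x v w + c * TwoForm.bilin (η i) x v w = 0 :=
    congrArg (fun θ : TwoForm E M ↦ θ x ![v, w]) habc
  have h0 : a = 0 := hN.coeff_eq_zero (t := z) (t' := i) (r := o) (c := c) hzi hzo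
    fun s hs w ↦ by
      have := hg s w
      rwa [(hN.mem_iff o s).1 hs w, mul_zero, add_zero] at this
  have h1 : b = 0 := hN.coeff_eq_zero (t := o) (t' := i) (r := z) (c := c) hoi hzo.symm
    fun s hs w ↦ by
      have := hg s w
      rwa [h0, zero_mul, zero_add] at this
  have h2 : c = 0 := hN.coeff_eq_zero (t := i) (t' := o) (r := z) (c := 0) hoi.symm hzi.symm
    fun s hs w ↦ by
      have := hg s w
      rw [h0, h1] at this
      linear_combination this
  exact ⟨h0, h1, h2⟩

/-- In the expression of the form with null-space `S t` through three others, all coefficients are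
nonzero. -/
lemma GeneratesWeb.exists_eq_ne_zero (hS : IsSL2Web n S) {Ω : Submodule ℂ (TwoForm E M)}
    (hΩ : GeneratesWeb Ω S) {η : CP1 → TwoForm E M} (hηΩ : ∀ t, η t ∈ Ω)
    (hη : ∀ t, S t = TwoForm.null (η t)) {z o i t : CP1} (hzo : z ≠ o) (hzi : z ≠ i) (hoi : o ≠ i)
    (htz : t ≠ z) (hto : t ≠ o) (hti : t ≠ i) :
    ∃ a b c : ℂ, η t = a • η z + b • η o + c • η i ∧ a ≠ 0 ∧ b ≠ 0 ∧ c ≠ 0 := by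
  obtain ⟨a, b, c, habc⟩ := hΩ.exists_eq hS hηΩ hη hzo hzi hoi (hηΩ t)
  obtain ⟨x⟩ := hΩ.nonempty
  have hN := hS.isNullFamily hη x
  have hrel (s w : TangentSpace 𝓘(ℂ, E) x) : TwoForm.bilin (η t) x s w =
      a * TwoForm.bilin (η z) x s w + b * TwoForm.bilin (η o) x s w +
        c * TwoForm.bilin (η i) x s w := by
    rw [habc]; simp
  have hrel' (s) (hs : s ∈ S t x) (w : TangentSpace 𝓘(ℂ, E) x) :
      a * TwoForm.bilin (η z) x s w + b * TwoForm.bilin (η o) x s w +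
        c * TwoForm.bilin (η i) x s w = 0 := by
    rw [← hrel]; exact (hN.mem_iff t s).1 hs w
  have hnz : ¬ (a = 0 ∧ b = 0 ∧ c = 0) := by
    rintro ⟨rfl, rfl, rfl⟩
    obtain ⟨v, hv, hv0⟩ := hN.exists_ne_zero z
    refine hv0 (hN.eq_zero_of_mem htz ((hN.mem_iff t v).2 fun w ↦ ?_) hv)
    rw [hrel]; ring
  refine ⟨a, b, c, habc, ?_, ?_, ?_⟩
  · rintro rfl
    exact hnz ⟨rfl, hN.coeff_eq_zero hoi hto.symm (c := c) fun s hs w ↦ by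
      linear_combination hrel' s hs w, hN.coeff_eq_zero hoi.symm hti.symm (c := b) fun s hs w ↦ by
      linear_combination hrel' s hs w⟩
  · rintro rfl
    exact hnz ⟨hN.coeff_eq_zero hzi htz.symm (c := c) fun s hs w ↦ by
      linear_combination hrel' s hs w, rfl, hN.coeff_eq_zero hzi.symm hti.symm (c := a)
      fun s hs w ↦ by linear_combination hrel' s hs w⟩
  · rintro rfl
    exact hnz ⟨hN.coeff_eq_zero hzo htz.symm (c := b) fun s hs w ↦ by
      linear_combination hrel' s hs w, hN.coeff_eq_zero hzo.symm hto.symm (c := a) fun s hs w ↦ by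
      linear_combination hrel' s hs w, rfl⟩

/-- In the decomposition `TM = S z ⊕ S i`, every `S t` is a constant multiple of the graph `S o`. -/
theorem GeneratesWeb.exists_add_smul_mem (hS : IsSL2Web n S) {Ω : Submodule ℂ (TwoForm E M)}
    (hΩ : GeneratesWeb Ω S) {z o i p q : CP1} (hzo : z ≠ o) (hzi : z ≠ i) (hoi : o ≠ i)
    (hpz : p ≠ z) (hpo : p ≠ o) (hpi : p ≠ i) (hqz : q ≠ z) (hqo : q ≠ o) (hqi : q ≠ i)
    (hpq : p ≠ q) {t : CP1} (htz : t ≠ z) (hto : t ≠ o) (hti : t ≠ i) :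
    ∃ l : ℂ, l ≠ 0 ∧ l ≠ 1 ∧
      ∀ x, ∀ u ∈ S z x, ∀ v ∈ S i x, u + v ∈ S o x → u + l • v ∈ S t x := by
  choose η hηΩ hη using hΩ.generates
  have hrel {t : CP1} (htz : t ≠ z) (hto : t ≠ o) (hti : t ≠ i) : ∃ a c e : ℂ, a ≠ 0 ∧ c ≠ 0 ∧
      ∀ x s w, TwoForm.bilin (η t) x s w = e * (a * TwoForm.bilin (η z) x s w +
        TwoForm.bilin (η o) x s w + c * TwoForm.bilin (η i) x s w) ∧ e ≠ 0 := by
    -- Dividing by `b` normalises the coefficient of `η o` to 1; the scale survives as `e`.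
    obtain ⟨a, b, c, habc, ha, hb, hc⟩ := hΩ.exists_eq_ne_zero hS hηΩ hη hzo hzi hoi htz hto hti
    refine ⟨a / b, c / b, b, div_ne_zero ha hb, div_ne_zero hc hb, fun x s w ↦ ⟨?_, hb⟩⟩
    rw [habc]
    simp
    field_simp
  have hrel' {t : CP1} {a c e : ℂ}
      (h : ∀ x s w, TwoForm.bilin (η t) x s w = e * (a * TwoForm.bilin (η z) x s w +
        TwoForm.bilin (η o) x s w + c * TwoForm.bilin (η i) x s w) ∧ e ≠ 0)
      (x : M) (s) (hs : s ∈ S t x) (w) : a * TwoForm.bilin (η z) x s w +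
        TwoForm.bilin (η o) x s w + c * TwoForm.bilin (η i) x s w = 0 := by
    have h1 := (((hS.isNullFamily hη x).mem_iff t s).1 hs w).symm.trans (h x s w).1
    exact (mul_eq_zero.1 h1.symm).resolve_left (h x s w).2
  obtain ⟨a, c, e, ha, hc, hp⟩ := hrel hpz hpo hpi
  obtain ⟨a', c', e', ha', hc', hq⟩ := hrel hqz hqo hqi
  obtain ⟨a'', c'', e'', ha'', hc'', ht⟩ := hrel htz hto hti
  obtain ⟨x₀⟩ := hΩ.nonempty
  have hdet : a * c' - a' * c ≠ 0 := (hS.isNullFamily hη x₀).det_ne_zero hzi hoi hpo hqo hpq hc' ha'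
    (hrel' hp x₀) (hrel' hq x₀) fun s w ↦ (hq x₀ s w).1
  -- This factor is built from coefficients of relations in `Ω`, so it does not depend on the point;
  -- hence neither does the slope.
  set k : ℂ := -(a * a' * (c' - c) / (a * c' - a' * c)) with hk
  have hmem (x) (u) (hu : u ∈ S z x) (v) (hv : v ∈ S i x) (huv : u + v ∈ S o x) :
      u + (k / a'' / (k / a'' + 1)) • v ∈ S t x :=
    (hS.isNullFamily hη x).add_smul_mem hzi hzo.symm hto hti ha'' (hrel' ht x)
      (fun d hd w hw ↦ (hS.isNullFamily hη x).apply_eq_mul_apply hzi hoi hpo hqo hdet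
        (hrel' hp x) (hrel' hq x) hd hw) hu hv huv
  refine ⟨_, ?_, ?_, hmem⟩
  -- Slope 0 would make a nonzero vector of `S o` lie in `S i`, and slope 1 would make one lie in `S
  -- t`; both contradict transversality.
  all_goals
    intro hl
    rw [hl] at hmem
    have hN := hS.isNullFamily hη x₀
    obtain ⟨s, hs, hs0⟩ := hN.exists_ne_zero o
    obtain ⟨u, hu, v, hv, rfl⟩ := hN.exists_add hzi s
    have := hmem x₀ u hu v hv hs
  · rw [zero_smul, add_zero] at this
    rw [hN.eq_zero_of_mem htz this hu, zero_add] at hs hs0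
    exact hs0 (hN.eq_zero_of_mem hoi hs hv)
  · rw [one_smul] at this
    exact hs0 (hN.eq_zero_of_mem hto this hs)

end Constants

/-! ### Holomorphic fields of endomorphisms -/

section Endomorphisms

variable {E : Type*} [NormedAddCommGroup E] [NormedSpace ℂ E]
  {M : Type*} [TopologicalSpace M] [ChartedSpace E M]

variable (E M) in
/-- Fields of endomorphisms of the tangent spaces, with no regularity imposed. -/
abbrev EndField : Type _ := Π x : M, TangentSpace 𝓘(ℂ, E) x →L[ℂ] TangentSpace 𝓘(ℂ, E) x

variable [IsManifold 𝓘(ℂ, E) ω M]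

/-- The vector field `X` is holomorphic near `x`. -/
abbrev HolomorphicAt (X : VField E M) (x : M) : Prop :=
  ContMDiffAt 𝓘(ℂ, E) (𝓘(ℂ, E).prod 𝓘(ℂ, E)) ω
    (fun x ↦ (⟨x, X x⟩ : TotalSpace E (TangentSpace 𝓘(ℂ, E) : M → Type _))) x

/-- The field of endomorphisms `A` is holomorphic near `x`. -/
abbrev EndHolomorphicAt (A : EndField E M) (x : M) : Prop :=
  ContMDiffAt 𝓘(ℂ, E) (𝓘(ℂ, E).prod 𝓘(ℂ, E →L[ℂ] E)) ω
    (fun x ↦ (⟨x, A x⟩ : TotalSpace (E →L[ℂ] E)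
      fun x : M ↦ TangentSpace 𝓘(ℂ, E) x →L[ℂ] TangentSpace 𝓘(ℂ, E) x)) x

/-- The vector field `X` is complex differentiable at `x`. -/
abbrev DiffAt (X : VField E M) (x : M) : Prop :=
  MDifferentiableAt 𝓘(ℂ, E) (𝓘(ℂ, E).prod 𝓘(ℂ, E))
    (fun x ↦ (⟨x, X x⟩ : TotalSpace E (TangentSpace 𝓘(ℂ, E) : M → Type _))) x

lemma HolomorphicAt.diffAt {X : VField E M} {x : M} (h : HolomorphicAt X x) : DiffAt X x :=
  h.mdifferentiableAt (by simp)

lemma HolomorphicOn.holomorphicAt {X : VField E M} {U : Set M} (h : HolomorphicOn X U)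
    (hU : IsOpen U) {x : M} (hx : x ∈ U) : HolomorphicAt X x :=
  ContMDiffOn.contMDiffAt h (hU.mem_nhds hx)

lemma HolomorphicAt.exists_holomorphicOn {X : VField E M} {x : M} (h : HolomorphicAt X x) :
    ∃ U, IsOpen U ∧ x ∈ U ∧ HolomorphicOn X U := by
  have := (contMDiffAt_iff_contMDiffAt_nhds (by simp)).1 h
  obtain ⟨U, hU, hUo, hxU⟩ := eventually_nhds_iff.1 this
  exact ⟨U, hUo, hxU, fun y hy ↦ (hU y hy).contMDiffWithinAt⟩

lemma EndHolomorphicAt.holomorphicAt {A : EndField E M} {X : VField E M} {x : M}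
    (hA : EndHolomorphicAt A x) (hX : HolomorphicAt X x) :
    HolomorphicAt (fun y ↦ A y (X y)) x :=
  ContMDiffAt.clm_bundle_apply hA hX

lemma EndHolomorphicAt.diffAt {A : EndField E M} {X : VField E M} {x : M}
    (hA : EndHolomorphicAt A x) (hX : DiffAt X x) : DiffAt (fun y ↦ A y (X y)) x :=
  MDifferentiableAt.clm_bundle_apply (hA.mdifferentiableAt (by simp)) hX

lemma HolomorphicAt.mlieBracket [CompleteSpace E] {X Y : VField E M} {x : M} (hX : HolomorphicAt X x)
    (hY : HolomorphicAt Y x) :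
    HolomorphicAt (VectorField.mlieBracket 𝓘(ℂ, E) X Y) x := by
  -- As `ω + 1 = ω`, the derivative taken by the bracket costs no regularity.
  have : IsManifold 𝓘(ℂ, E) (ω + 1) M := inferInstanceAs (IsManifold 𝓘(ℂ, E) ω M)
  rw [HolomorphicAt, ← contMDiffWithinAt_univ] at *
  rw [← VectorField.mlieBracketWithin_univ]
  exact hX.mlieBracketWithin_vectorField (n := ω) hY uniqueMDiffOn_univ (Set.mem_univ _) (by simp)

instance (x : M) : T2Space (TangentSpace 𝓘(ℂ, E) x) := inferInstanceAs (T2Space E)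

variable [FiniteDimensional ℂ E]

/-- A field of endomorphisms is holomorphic if it maps a holomorphic frame to holomorphic vector
fields. -/
lemma endHolomorphicAt_of_frame {ι : Type*} [Fintype ι] (hι : Fintype.card ι = finrank ℂ E)
    {A : EndField E M} {e : ι → VField E M} {x₀ : M} (he : ∀ i, HolomorphicAt (e i) x₀)
    (hAe : ∀ i, HolomorphicAt (fun x ↦ A x (e i x)) x₀)
    (hli : ∀ᶠ x in 𝓝 x₀, LinearIndependent ℂ fun i ↦ e i x) : EndHolomorphicAt A x₀ := by
  have : CompleteSpace E := FiniteDimensional.complete ℂ E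
  let t := trivializationAt E (TangentSpace 𝓘(ℂ, E) : M → Type _) x₀
  have ht : t.baseSet ∈ 𝓝 x₀ := t.open_baseSet.mem_nhds (FiberBundle.mem_baseSet_trivializationAt' x₀)
  let R : ι → E →L[ℂ] (ι → ℂ) →L[ℂ] E := fun i ↦
    ContinuousLinearMap.smulRightL ℂ (ι → ℂ) E (ContinuousLinearMap.proj i)
  let G (X : ι → VField E M) (x : M) : (ι → ℂ) →L[ℂ] E := ∑ i, R i (t ⟨x, X i x⟩).2
  have hG {X : ι → VField E M} (hX : ∀ i, HolomorphicAt (X i) x₀) :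
      ContMDiffAt 𝓘(ℂ, E) 𝓘(ℂ, (ι → ℂ) →L[ℂ] E) ω (G X) x₀ := by
    refine ContMDiffAt.sum fun i _ ↦ ?_
    exact (R i).contMDiff.contMDiffAt.comp x₀ ((contMDiffAt_section _).1 (hX i))
  have hGapply (X : ι → VField E M) {x : M} (hx : x ∈ t.baseSet) (c : ι → ℂ) :
      G X x c = t.continuousLinearMapAt ℂ x (∑ i, c i • X i x) := by
    simp only [G, R, map_sum, map_smul, sum_apply]
    refine Finset.sum_congr rfl fun i _ ↦ ?_
    simp [hx]
  have hinv {x : M} (hx : x ∈ t.baseSet) (hl : LinearIndependent ℂ fun i ↦ e i x) :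
      ∃ g : (ι → ℂ) ≃L[ℂ] E, (g : (ι → ℂ) →L[ℂ] E) = G e x := by
    have hinj : Function.Injective (G e x : (ι → ℂ) →ₗ[ℂ] E) := by
      rw [← LinearMap.ker_eq_bot, LinearMap.ker_eq_bot']
      intro c hc
      have hc' : t.continuousLinearMapAt ℂ x (∑ i, c i • e i x) = 0 := (hGapply e hx c) ▸ hc
      have h0 : ∑ i, c i • e i x = 0 := by
        rw [← t.symmL_continuousLinearMapAt (R := ℂ) hx (∑ i, c i • e i x), hc', map_zero]
      exact funext (Fintype.linearIndependent_iff.1 hl c h0)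
    refine ⟨(LinearEquiv.ofInjectiveOfFinrankEq _ hinj (by simpa using hι)).toContinuousLinearEquiv,
      ?_⟩
    ext; rfl
  refine (contMDiffAt_hom_bundle _).2 ⟨contMDiffAt_id, ?_⟩
  -- In coordinates `A` is the matrix of the images of the frame times the inverse of the matrix of
  -- the frame; inversion is analytic at an invertible map.
  have hmain : ContMDiffAt 𝓘(ℂ, E) 𝓘(ℂ, E →L[ℂ] E) ω
      (fun x ↦ (G (fun i x ↦ A x (e i x)) x).comp (G e x).inverse) x₀ := by
    refine (hG hAe).clm_comp ?_
    obtain ⟨g, hg⟩ := hinv (mem_of_mem_nhds ht) hli.self_of_nhds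
    have := contDiffAt_map_inverse (n := ω) g
    rw [hg] at this
    exact this.contMDiffAt.comp x₀ (hG he)
  refine hmain.congr_of_eventuallyEq ?_
  filter_upwards [ht, hli] with x hx hl
  obtain ⟨g, hg⟩ := hinv hx hl
  rw [← hg, ContinuousLinearMap.inverse_equiv]
  ext v
  obtain ⟨c, rfl⟩ := g.surjective v
  have hgc : g c = G e x c := by rw [← hg]; rfl
  simp only [ContinuousLinearMap.comp_apply, ContinuousLinearEquiv.coe_coe, g.symm_apply_apply]
  rw [ContinuousLinearMap.inCoordinates, hgc, hGapply e hx,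
    hGapply (fun i x ↦ A x (e i x)) hx]
  change t.continuousLinearMapAt ℂ x (A x (t.symmL ℂ x _)) = _
  rw [t.symmL_continuousLinearMapAt (R := ℂ) hx]
  simp [map_sum]

omit [FiniteDimensional ℂ E] in
/-- A holomorphic vector field with values in `D` through a given vector of `D`. -/
lemma IsHolomorphicSubbundle.exists_section {n : ℕ} {D : Distribution E M}
    (hD : IsHolomorphicSubbundle n D) {x : M} {v : TangentSpace 𝓘(ℂ, E) x} (hv : v ∈ D x) :
    ∃ U : Set M, IsOpen U ∧ x ∈ U ∧ ∃ X : VField E M, HolomorphicOn X U ∧ (∀ y ∈ U, X y ∈ D y) ∧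
      X x = v := by
  obtain ⟨U, hU, hxU, s, hs, hsU⟩ := hD x
  rw [← (hsU x hxU).2] at hv
  obtain ⟨c, hc⟩ := (Submodule.mem_span_range_iff_exists_fun ℂ).1 hv
  refine ⟨U, hU, hxU, fun y ↦ ∑ i, c i • s i y, ?_, fun y hy ↦ ?_, hc⟩
  · exact ContMDiffOn.sum_section fun i _ ↦ (contMDiffOn_const (c := c i)).smul_section (hs i)
  · rw [← (hsU y hy).2]
    exact Submodule.sum_mem _ fun i _ ↦ Submodule.smul_mem _ _ (Submodule.subset_span ⟨i, rfl⟩)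

/-! ### Projections onto a distribution along a complementary one -/

/-- The field of projections onto `D` along `D'`. -/
def projField (D D' : Distribution E M) (h : ∀ x, IsCompl (D x) (D' x)) : EndField E M :=
  fun x ↦ LinearMap.toContinuousLinearMap ((D x).projection (D' x) (h x))

omit [IsManifold 𝓘(ℂ, E) ω M] in
lemma projField_mem {D D' : Distribution E M} (h : ∀ x, IsCompl (D x) (D' x)) (x : M)
    (v : TangentSpace 𝓘(ℂ, E) x) : projField D D' h x v ∈ D x :=
  Submodule.projection_apply_mem (h x) v

omit [IsManifold 𝓘(ℂ, E) ω M] in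
lemma projField_of_mem {D D' : Distribution E M} (h : ∀ x, IsCompl (D x) (D' x)) {x : M}
    {v : TangentSpace 𝓘(ℂ, E) x} (hv : v ∈ D x) : projField D D' h x v = v :=
  Submodule.projection_apply_of_mem_left (h x) hv

omit [IsManifold 𝓘(ℂ, E) ω M] in
lemma projField_of_mem_right {D D' : Distribution E M} (h : ∀ x, IsCompl (D x) (D' x)) {x : M}
    {v : TangentSpace 𝓘(ℂ, E) x} (hv : v ∈ D' x) : projField D D' h x v = 0 :=
  (Submodule.projection_apply_eq_zero_iff (h x)).2 hv

omit [IsManifold 𝓘(ℂ, E) ω M] in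
lemma sub_projField_mem {D D' : Distribution E M} (h : ∀ x, IsCompl (D x) (D' x)) (x : M)
    (v : TangentSpace 𝓘(ℂ, E) x) : v - projField D D' h x v ∈ D' x := by
  rw [← Submodule.projection_apply_eq_zero_iff (h x)]
  change projField D D' h x (v - projField D D' h x v) = 0
  rw [map_sub, projField_of_mem h (projField_mem h x v), sub_self]

/-- Local frames of `D` and `D'` together form a frame of the tangent bundle, each member of which
is either fixed or killed. -/
lemma projField_holomorphicAt {n : ℕ} {D D' : Distribution E M} (h : ∀ x, IsCompl (D x) (D' x))
    (hn : finrank ℂ E = 2 * n) (hD : IsHolomorphicSubbundle n D)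
    (hD' : IsHolomorphicSubbundle n D') (x : M) : EndHolomorphicAt (projField D D' h) x := by
  obtain ⟨U, hU, hxU, s, hs, hsU⟩ := hD x
  obtain ⟨U', hU', hxU', s', hs', hsU'⟩ := hD' x
  have hmem {y : M} (hy : y ∈ U) (i) : s i y ∈ D y :=
    (hsU y hy).2 ▸ Submodule.subset_span ⟨i, rfl⟩
  have hmem' {y : M} (hy : y ∈ U') (i) : s' i y ∈ D' y :=
    (hsU' y hy).2 ▸ Submodule.subset_span ⟨i, rfl⟩
  refine endHolomorphicAt_of_frame (ι := Fin n ⊕ Fin n) (e := Sum.elim s s')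
    (by simp [hn, two_mul]) ?_ ?_ ?_
  · rintro (i | i)
    exacts [(hs i).holomorphicAt hU hxU, (hs' i).holomorphicAt hU' hxU']
  · rintro (i | i)
    · refine ((hs i).holomorphicAt hU hxU).congr_of_eventuallyEq ?_
      filter_upwards [hU.mem_nhds hxU] with y hy
      simp only [Sum.elim_inl, projField_of_mem h (hmem hy i)]
    · have h0 : HolomorphicAt (0 : VField E M) x := contMDiff_zeroSection ℂ _ x
      refine h0.congr_of_eventuallyEq ?_
      filter_upwards [hU'.mem_nhds hxU'] with y hy
      simp only [Sum.elim_inr, projField_of_mem_right h (hmem' hy i), Pi.zero_apply]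
  · filter_upwards [hU.mem_nhds hxU, hU'.mem_nhds hxU'] with y hy hy'
    have hd : Disjoint (Submodule.span ℂ (Set.range fun i ↦ s i y))
        (Submodule.span ℂ (Set.range fun i ↦ s' i y)) := by
      rw [(hsU y hy).2, (hsU' y hy').2]; exact (h y).disjoint
    have := LinearIndependent.sum_type (hsU y hy).1 (hsU' y hy').1 hd
    have he : (fun i ↦ Sum.elim s s' i y) = Sum.elim (fun i ↦ s i y) fun i ↦ s' i y := by
      ext i; cases i <;> rfl
    rw [he]
    exact this

end Endomorphisms

/-! ### The connection of a splitting -/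

section Connection

open VectorField

variable {E : Type*} [NormedAddCommGroup E] [NormedSpace ℂ E]
  {M : Type*} [TopologicalSpace M] [ChartedSpace E M]

/-- The vector field obtained by applying a field of endomorphisms to a vector field. -/
def EndField.app (A : EndField E M) (X : VField E M) : VField E M := fun x ↦ A x (X x)

namespace EndField

variable (A : EndField E M) (X Y : VField E M)

lemma app_apply (x : M) : A.app X x = A x (X x) := rfl

lemma app_add : A.app (X + Y) = A.app X + A.app Y := by
  ext x; exact map_add (A x) _ _

lemma app_smul (f : M → ℂ) : A.app (f • X) = f • A.app X := by
  ext x; exact map_smul (A x) _ _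

end EndField

variable [IsManifold 𝓘(ℂ, E) ω M]

/-- Complementary holomorphic projections `P` and `Q` on the tangent bundle together with a
holomorphic involution `J` exchanging their images. -/
structure IsSplitting (P Q J : EndField E M) : Prop where
  holP : ∀ x, EndHolomorphicAt P x
  holQ : ∀ x, EndHolomorphicAt Q x
  holJ : ∀ x, EndHolomorphicAt J x
  add_apply : ∀ x v, P x v + Q x v = v
  P_P : ∀ x v, P x (P x v) = P x v
  J_P : ∀ x v, J x (P x v) = Q x (J x v)
  J_J : ∀ x v, J x (J x v) = v

namespace IsSplitting

variable {P Q J : EndField E M} (h : IsSplitting P Q J)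
include h

lemma Q_apply (x : M) (v : TangentSpace 𝓘(ℂ, E) x) : Q x v = v - P x v :=
  eq_sub_of_add_eq' (h.add_apply x v)

lemma P_Q (x : M) (v : TangentSpace 𝓘(ℂ, E) x) : P x (Q x v) = 0 := by
  rw [h.Q_apply, map_sub, h.P_P, sub_self]

lemma Q_P (x : M) (v : TangentSpace 𝓘(ℂ, E) x) : Q x (P x v) = 0 := by
  rw [h.Q_apply, h.P_P, sub_self]

lemma Q_Q (x : M) (v : TangentSpace 𝓘(ℂ, E) x) : Q x (Q x v) = Q x v := by
  rw [h.Q_apply x (Q x v), h.P_Q, sub_zero]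

lemma J_Q (x : M) (v : TangentSpace 𝓘(ℂ, E) x) : J x (Q x v) = P x (J x v) := by
  have h1 := h.add_apply x (J x v)
  rw [← h.J_P, ← eq_sub_iff_add_eq, ← map_sub, ← h.Q_apply] at h1
  exact h1.symm

lemma diffP {X : VField E M} {x : M} (hX : DiffAt X x) : DiffAt (P.app X) x :=
  (h.holP x).diffAt hX

lemma diffQ {X : VField E M} {x : M} (hX : DiffAt X x) : DiffAt (Q.app X) x :=
  (h.holQ x).diffAt hX

lemma diffJ {X : VField E M} {x : M} (hX : DiffAt X x) : DiffAt (J.app X) x :=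
  (h.holJ x).diffAt hX

omit h in
variable (P Q J) in
/-- The expression `P[QX, PY] + JQ[PX, JPY] + Q[PX, QY] + JP[QX, JQY]`. -/
def bracketExpr (X Y : VField E M) : VField E M := fun x ↦
  P x (mlieBracket 𝓘(ℂ, E) (Q.app X) (P.app Y) x) +
  J x (Q x (mlieBracket 𝓘(ℂ, E) (P.app X) (J.app (P.app Y)) x)) +
  Q x (mlieBracket 𝓘(ℂ, E) (P.app X) (Q.app Y) x) +
  J x (P x (mlieBracket 𝓘(ℂ, E) (Q.app X) (J.app (Q.app Y)) x))

variable [CompleteSpace E]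

/-- Replacing `X` by `f • X` adds to each bracket a multiple of `PX` or `QX`, and the projection in
front of that bracket is the one that kills it. -/
lemma bracketExpr_tensorialAt (Y : VField E M) (x : M) :
    TensorialAt 𝓘(ℂ, E) E (fun X ↦ bracketExpr P Q J X Y x) x where
  smul {f X} hf hX := by
    have hP := h.diffP hX
    have hQ := h.diffQ hX
    simp only [bracketExpr, EndField.app_smul, mlieBracket_smul_left hf hP,
      mlieBracket_smul_left hf hQ, map_add, map_smul, EndField.app_apply, h.P_Q, h.Q_P, smul_zero, smul_add, zero_add]
  add {X X'} hX hX' := by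
    have hP := h.diffP hX
    have hQ := h.diffQ hX
    have hP' := h.diffP hX'
    have hQ' := h.diffQ hX'
    simp only [bracketExpr, EndField.app_add, mlieBracket_add_left hP hP',
      mlieBracket_add_left hQ hQ', map_add]
    abel

lemma bracketExpr_add {X Y Y' : VField E M} {x : M} (hY : DiffAt Y x) (hY' : DiffAt Y' x) :
    bracketExpr P Q J X (Y + Y') x = bracketExpr P Q J X Y x + bracketExpr P Q J X Y' x := by
  have hP := h.diffP hY
  have hQ := h.diffQ hY
  have hP' := h.diffP hY'
  have hQ' := h.diffQ hY'
  simp only [bracketExpr, EndField.app_add, mlieBracket_add_right hP hP',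
    mlieBracket_add_right hQ hQ', mlieBracket_add_right (h.diffJ hP)
    (h.diffJ hP'), mlieBracket_add_right (h.diffJ hQ)
    (h.diffJ hQ'), map_add]
  abel

/-- The derivatives of `f` along `QX` and `PX` in the first two terms both multiply `PY`, because
`J` squares to 1; those in the last two multiply `QY`. They add up to the derivative along `X` times
`Y`. -/
lemma bracketExpr_smul {X Y : VField E M} {f : M → ℂ} {x : M} (hY : DiffAt Y x)
    (hf : MDifferentiableAt 𝓘(ℂ, E) 𝓘(ℂ, ℂ) f x) :
    bracketExpr P Q J X (f • Y) x =
      f x • bracketExpr P Q J X Y x + mvfderiv 𝓘(ℂ, E) f x (X x) • Y x := by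
  have hP := h.diffP hY
  have hQ := h.diffQ hY
  have hX : mvfderiv 𝓘(ℂ, E) f x (X x) =
      mvfderiv 𝓘(ℂ, E) f x (P x (X x)) + mvfderiv 𝓘(ℂ, E) f x (Q x (X x)) := by
    rw [← map_add, h.add_apply]
  simp only [bracketExpr, EndField.app_smul, mlieBracket_smul_right hf hP,
    mlieBracket_smul_right hf hQ, mlieBracket_smul_right hf (h.diffJ hP),
    mlieBracket_smul_right hf (h.diffJ hQ), map_add, map_smul, EndField.app_apply,
    h.P_P, h.Q_Q, ← h.J_P, ← h.J_Q, h.J_J, hX]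
  have hY' := h.add_apply x (Y x)
  nth_rw 5 [← hY']
  module

lemma bracketExpr_holomorphicAt {X Y : VField E M} {x : M} (hX : HolomorphicAt X x)
    (hY : HolomorphicAt Y x) : HolomorphicAt (bracketExpr P Q J X Y) x := by
  have hP {Z : VField E M} (hZ : HolomorphicAt Z x) : HolomorphicAt (P.app Z) x :=
    (h.holP x).holomorphicAt hZ
  have hQ {Z : VField E M} (hZ : HolomorphicAt Z x) : HolomorphicAt (Q.app Z) x :=
    (h.holQ x).holomorphicAt hZ
  have hJ {Z : VField E M} (hZ : HolomorphicAt Z x) : HolomorphicAt (J.app Z) x :=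
    (h.holJ x).holomorphicAt hZ
  exact (((hP ((hQ hX).mlieBracket (hP hY))).add_section
    (hJ (hQ ((hP hX).mlieBracket (hJ (hP hY)))))).add_section
    (hQ ((hP hX).mlieBracket (hQ hY)))).add_section (hJ (hP ((hQ hX).mlieBracket (hJ (hQ hY)))))

variable [FiniteDimensional ℂ E]

/-- The connection `∇_X Y = P[QX, PY] + JQ[PX, JPY] + Q[PX, QY] + JP[QX, JQY]`. -/
def connection : CovariantDerivative 𝓘(ℂ, E) E (TangentSpace 𝓘(ℂ, E) : M → Type _) where
  toFun Y x := TensorialAt.mkHom (fun X ↦ bracketExpr P Q J X Y x) x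
    (h.bracketExpr_tensorialAt Y x)
  isCovariantDerivativeOnUniv :=
    { add := by
        intro Y Y' x hY hY' _
        ext v
        simp only [TensorialAt.mkHom_apply_eq_extend, _root_.add_apply]
        exact h.bracketExpr_add hY hY'
      leibniz := by
        intro Y f x hY hf _
        ext v
        simp only [TensorialAt.mkHom_apply_eq_extend, _root_.add_apply,
          _root_.smul_apply, ContinuousLinearMap.smulRight_apply]
        have := h.bracketExpr_smul (X := FiberBundle.extend E v) hY hf
        rwa [FiberBundle.extend_apply_self] at this }

lemma connection_apply {X Y : VField E M} {x : M} (hX : DiffAt X x) :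
    h.connection Y x (X x) = bracketExpr P Q J X Y x :=
  TensorialAt.mkHom_apply (h.bracketExpr_tensorialAt Y x) hX

lemma connection_apply_eq_extend (Y : VField E M) (x : M) (v : TangentSpace 𝓘(ℂ, E) x) :
    h.connection Y x v = bracketExpr P Q J (FiberBundle.extend E v) Y x := rfl

/-- Testing the endomorphism field `∇Y` on a local frame gives bracket expressions in analytic
fields. -/
lemma isHolomorphicConnection : IsHolomorphicConnection h.connection := by
  intro U hU
  refine ⟨fun {Y} hY x hx ↦ ContMDiffAt.contMDiffWithinAt ?_⟩
  replace hY : HolomorphicAt Y x := HolomorphicOn.holomorphicAt (U := U) hY hU hx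
  let t := trivializationAt E (TangentSpace 𝓘(ℂ, E) : M → Type _) x
  have hxt : x ∈ t.baseSet := FiberBundle.mem_baseSet_trivializationAt' x
  let b := Module.finBasis ℂ E
  have he {y : M} (hy : y ∈ t.baseSet) (i) : HolomorphicAt (t.localFrame b i) y :=
    contMDiffAt_localFrame_of_mem ω t b i hy
  refine endHolomorphicAt_of_frame (A := h.connection Y) (e := t.localFrame b) (by simp)
    (he hxt) (fun i ↦ ?_) ?_
  · refine (h.bracketExpr_holomorphicAt (he hxt i) hY).congr_of_eventuallyEq ?_
    filter_upwards [t.open_baseSet.mem_nhds hxt] with y hy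
    rw [h.connection_apply (he hy i).diffAt]
  · filter_upwards [t.open_baseSet.mem_nhds hxt] with y hy
    exact (t.isLocalFrameOn_localFrame_baseSet 𝓘(ℂ, E) ω b).linearIndependent hy

/-- The connection preserves the graph of `l • J`. -/
lemma Q_connection {Y : VField E M} {x : M} (hY : DiffAt Y x) {l : ℂ}
    (hl : ∀ᶠ y in 𝓝 x, Q y (Y y) = l • J y (P y (Y y))) (v : TangentSpace 𝓘(ℂ, E) x) :
    Q x (h.connection Y x v) = l • J x (P x (h.connection Y x v)) := by
  have hQ : Q.app Y =ᶠ[𝓝 x] l • J.app (P.app Y) := hl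
  have hJQ : J.app (Q.app Y) =ᶠ[𝓝 x] l • P.app Y := by
    filter_upwards [hl] with y hy
    rw [EndField.app_apply, EndField.app_apply, hy, map_smul, h.J_J]
    rfl
  rw [h.connection_apply_eq_extend]
  set X := FiberBundle.extend E v
  have hPY := h.diffP hY
  -- Because `l` is a constant it leaves the brackets without a derivative term; what is left is the
  -- graph identity between the `P` and `Q` parts.
  simp only [bracketExpr, Filter.EventuallyEq.rfl.mlieBracket_vectorField_eq hQ,
    Filter.EventuallyEq.rfl.mlieBracket_vectorField_eq hJQ,
    mlieBracket_const_smul_right hPY, mlieBracket_const_smul_right (h.diffJ hPY),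
    map_add, map_smul, h.P_P, h.Q_Q, ← h.J_P, ← h.J_Q, h.J_J, h.P_Q, h.Q_P, map_zero, smul_add]
  simp only [h.J_P, smul_zero, zero_add, add_zero]
  abel

/-- The connection preserves the kernel of `P`. -/
lemma P_connection {Y : VField E M} {x : M} (hY : ∀ᶠ y in 𝓝 x, P y (Y y) = 0)
    (v : TangentSpace 𝓘(ℂ, E) x) : P x (h.connection Y x v) = 0 := by
  have hP : P.app Y =ᶠ[𝓝 x] (0 : VField E M) := hY
  have hJP : J.app (P.app Y) =ᶠ[𝓝 x] (0 : VField E M) := by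
    filter_upwards [hY] with y hy
    rw [EndField.app_apply, EndField.app_apply, hy, map_zero]
    rfl
  rw [h.connection_apply_eq_extend]
  simp only [bracketExpr, Filter.EventuallyEq.rfl.mlieBracket_vectorField_eq hP,
    Filter.EventuallyEq.rfl.mlieBracket_vectorField_eq hJP, mlieBracket_zero_right, Pi.zero_apply,
    map_add, map_zero, zero_add, h.P_Q, h.J_P]

/-- The connection is torsion-free if `Q([X, JY] + [JX, Y]) = J[X, Y]` and
`[JX, JY] = JP([X, JY] + [JX, Y])` for holomorphic `X`, `Y` with `PX = X`, `PY = Y`. -/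
lemma torsion_eq_zero
    (h₁ : ∀ (X Y : VField E M) (x : M), HolomorphicAt X x → HolomorphicAt Y x → P.app X = X →
      P.app Y = Y → Q x (mlieBracket 𝓘(ℂ, E) X (J.app Y) x + mlieBracket 𝓘(ℂ, E) (J.app X) Y x) =
        J x (mlieBracket 𝓘(ℂ, E) X Y x))
    (h₂ : ∀ (X Y : VField E M) (x : M), HolomorphicAt X x → HolomorphicAt Y x → P.app X = X →
      P.app Y = Y → J x (P x (mlieBracket 𝓘(ℂ, E) X (J.app Y) x +
        mlieBracket 𝓘(ℂ, E) (J.app X) Y x)) = mlieBracket 𝓘(ℂ, E) (J.app X) (J.app Y) x) :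
    h.connection.torsion = 0 := by
  have hPX {x : M} (u : TangentSpace 𝓘(ℂ, E) x) : ∃ X : VField E M, HolomorphicAt X x ∧
      P.app X = X ∧ Q.app X = 0 ∧ X x = P x u :=
    ⟨P.app (FiberBundle.extend E u),
      (h.holP x).holomorphicAt (FiberBundle.contMDiffAt_extend 𝓘(ℂ, E) E u),
      funext fun y ↦ h.P_P y _, funext fun y ↦ h.Q_P y _,
      by rw [EndField.app_apply, FiberBundle.extend_apply_self]⟩
  have hQX {x : M} (u : TangentSpace 𝓘(ℂ, E) x) : ∃ X : VField E M, HolomorphicAt X x ∧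
      P.app X = 0 ∧ Q.app X = X ∧ X x = Q x u :=
    ⟨Q.app (FiberBundle.extend E u),
      (h.holQ x).holomorphicAt (FiberBundle.contMDiffAt_extend 𝓘(ℂ, E) E u),
      funext fun y ↦ h.P_Q y _, funext fun y ↦ h.Q_Q y _,
      by rw [EndField.app_apply, FiberBundle.extend_apply_self]⟩
  have hJ0 : J.app 0 = 0 := funext fun y ↦ map_zero (J y)
  -- In mixed directions `∇_X Y = Q[X, Y]` and `∇_Y X = P[Y, X]`, so torsion vanishes from `P + Q =
  -- 1` alone.
  have hPQ {x : M} (u v : TangentSpace 𝓘(ℂ, E) x) :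
      h.connection.torsion x (P x u) (Q x v) = 0 := by
    obtain ⟨X, hX, hXP, hXQ, hXu⟩ := hPX u
    obtain ⟨Y, hY, hYP, hYQ, hYv⟩ := hQX v
    rw [← hXu, ← hYv, h.connection.torsion_apply hX.diffAt hY.diffAt,
      h.connection_apply hX.diffAt, h.connection_apply hY.diffAt]
    simp only [bracketExpr, hXP, hXQ, hYP, hYQ, hJ0, mlieBracket_zero_left, mlieBracket_zero_right,
      Pi.zero_apply, map_zero, zero_add, add_zero]
    rw [mlieBracket_swap_apply (V := Y), map_neg, sub_neg_eq_add, add_comm (Q x _), h.add_apply,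
      sub_self]
  have hPP {x : M} (u v : TangentSpace 𝓘(ℂ, E) x) :
      h.connection.torsion x (P x u) (P x v) = 0 := by
    obtain ⟨X, hX, hXP, hXQ, hXu⟩ := hPX u
    obtain ⟨Y, hY, hYP, hYQ, hYv⟩ := hPX v
    rw [← hXu, ← hYv, h.connection.torsion_apply hX.diffAt hY.diffAt,
      h.connection_apply hX.diffAt, h.connection_apply hY.diffAt]
    simp only [bracketExpr, hXP, hXQ, hYP, hYQ, hJ0, mlieBracket_zero_left, mlieBracket_zero_right,
      Pi.zero_apply, map_zero, zero_add, add_zero]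
    have := congrArg (J x) (h₁ X Y x hX hY hXP hYP)
    rw [mlieBracket_swap_apply (V := Y), map_neg, map_neg, sub_neg_eq_add, ← map_add, ← map_add,
      this, h.J_J, sub_self]
  have hQQ {x : M} (u v : TangentSpace 𝓘(ℂ, E) x) :
      h.connection.torsion x (Q x u) (Q x v) = 0 := by
    obtain ⟨X, hX, hXP, hXQ, hXu⟩ := hQX u
    obtain ⟨Y, hY, hYP, hYQ, hYv⟩ := hQX v
    rw [← hXu, ← hYv, h.connection.torsion_apply hX.diffAt hY.diffAt,
      h.connection_apply hX.diffAt, h.connection_apply hY.diffAt]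
    simp only [bracketExpr, hXP, hXQ, hYP, hYQ, hJ0, mlieBracket_zero_left, mlieBracket_zero_right,
      Pi.zero_apply, map_zero, zero_add, add_zero]
    have hJJ (Z : VField E M) : J.app (J.app Z) = Z := funext fun y ↦ h.J_J y _
    have hPJ {Z : VField E M} (hZ : Q.app Z = Z) : P.app (J.app Z) = J.app Z := by
      conv_rhs => rw [← hZ]
      exact funext fun y ↦ (h.J_Q y (Z y)).symm
    -- Sections of the image of `Q` are `J` of sections of the image of `P`, so the second relation
    -- is applied to `JX` and `JY`.
    have := h₂ (J.app X) (J.app Y) x ((h.holJ x).holomorphicAt hX) ((h.holJ x).holomorphicAt hY)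
      (hPJ hXQ) (hPJ hYQ)
    rw [hJJ, hJJ] at this
    rw [mlieBracket_swap_apply (V := Y), map_neg, map_neg, sub_neg_eq_add, ← map_add, ← map_add,
      add_comm, this, sub_self]
  ext x u v
  have hu := h.add_apply x u
  have hv := h.add_apply x v
  change h.connection.torsion x u v = 0
  rw [← hu, ← hv]
  simp only [map_add, _root_.add_apply, hPP, hPQ, hQQ,
    h.connection.torsion_antisymm (Q x u) (P x v), neg_zero, add_zero]

end IsSplitting

end Connection

/-! ### Existence of the Chern connection -/

section Existence

open VectorField

variable {E : Type*} [NormedAddCommGroup E] [NormedSpace ℂ E]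
  {M : Type*} [TopologicalSpace M] [ChartedSpace E M] [IsManifold 𝓘(ℂ, E) ω M]
  [FiniteDimensional ℂ E]

lemma endHolomorphicAt_of_forall {A : EndField E M} {x : M}
    (hA : ∀ X : VField E M, HolomorphicAt X x → HolomorphicAt (A.app X) x) :
    EndHolomorphicAt A x := by
  let t := trivializationAt E (TangentSpace 𝓘(ℂ, E) : M → Type _) x
  have hxt : x ∈ t.baseSet := FiberBundle.mem_baseSet_trivializationAt' x
  let b := Module.finBasis ℂ E
  have he (i) : HolomorphicAt (t.localFrame b i) x := contMDiffAt_localFrame_of_mem ω t b i hxt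
  refine endHolomorphicAt_of_frame (e := t.localFrame b) (by simp) he (fun i ↦ hA _ (he i)) ?_
  filter_upwards [t.open_baseSet.mem_nhds hxt] with y hy
  exact (t.isLocalFrameOn_localFrame_baseSet 𝓘(ℂ, E) ω b).linearIndependent hy

variable {n : ℕ} {S : CP1 → Distribution E M}

/-- Three members of a web determine a splitting of the tangent bundle. -/
lemma IsSL2Web.exists_isSplitting (hS : IsSL2Web n S) {z o i : CP1} (hzo : z ≠ o) (hzi : z ≠ i)
    (hoi : o ≠ i) : ∃ P Q J : EndField E M, IsSplitting P Q J ∧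
      (∀ x v, v ∈ S z x ↔ Q x v = 0) ∧ (∀ x v, v ∈ S i x ↔ P x v = 0) ∧
      ∀ x, ∀ v ∈ S z x, v + J x v ∈ S o x := by
  let P := projField (S z) (S i) (hS.isCompl hzi)
  let Q := projField (S i) (S z) (hS.isCompl hzi.symm)
  let A := projField (S o) (S i) (hS.isCompl hoi)
  let B := projField (S o) (S z) (hS.isCompl hzo.symm)
  -- For `v` in `S z`, `A v - v` is the vector of `S i` that completes `v` to a point of `S o`; `B`
  -- does the same starting from `S i`.
  let J : EndField E M := fun x ↦ ((A x).comp (P x) - P x) + ((B x).comp (Q x) - Q x)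
  have hP (x) : EndHolomorphicAt P x :=
    projField_holomorphicAt _ hS.dim_eq (hS.subbundle z) (hS.subbundle i) x
  have hQ (x) : EndHolomorphicAt Q x :=
    projField_holomorphicAt _ hS.dim_eq (hS.subbundle i) (hS.subbundle z) x
  have hA (x) : EndHolomorphicAt A x :=
    projField_holomorphicAt _ hS.dim_eq (hS.subbundle o) (hS.subbundle i) x
  have hB (x) : EndHolomorphicAt B x :=
    projField_holomorphicAt _ hS.dim_eq (hS.subbundle o) (hS.subbundle z) x
  have hJ (x) : EndHolomorphicAt J x := endHolomorphicAt_of_forall fun X hX ↦ by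
    have hPX := (hP x).holomorphicAt hX
    have hQX := (hQ x).holomorphicAt hX
    exact (((hA x).holomorphicAt hPX).sub_section hPX).add_section
      (((hB x).holomorphicAt hQX).sub_section hQX)
  have hPz (x v) (hv : v ∈ S z x) : P x v = v := projField_of_mem _ hv
  have hPi (x v) (hv : v ∈ S i x) : P x v = 0 := projField_of_mem_right _ hv
  have hQi (x v) (hv : v ∈ S i x) : Q x v = v := projField_of_mem _ hv
  have hQz (x v) (hv : v ∈ S z x) : Q x v = 0 := projField_of_mem_right _ hv
  have hPmem (x v) : P x v ∈ S z x := projField_mem _ x v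
  have hQmem (x v) : Q x v ∈ S i x := projField_mem _ x v
  have hadd (x v) : P x v + Q x v = v := by
    have h1 : v - P x v ∈ S i x := sub_projField_mem _ x v
    have h2 := hQi x _ h1
    rw [map_sub, hQz x _ (hPmem x v), sub_zero] at h2
    rw [h2, add_sub_cancel]
  have hzero {t t' : CP1} (h : t ≠ t') {x : M} {v} (hv : v ∈ S t x) (hv' : v ∈ S t' x) : v = 0 :=
    Submodule.disjoint_def.1 (hS.isCompl h x).disjoint v hv hv'
  have hJz (x v) (hv : v ∈ S z x) : J x v ∈ S i x ∧ v + J x v ∈ S o x := by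
    have hJv : J x v = A x v - v := by
      change A x (P x v) - P x v + (B x (Q x v) - Q x v) = _
      rw [hPz x v hv, hQz x v hv, map_zero, sub_zero, add_zero]
    rw [hJv, add_sub_cancel]
    refine ⟨?_, projField_mem _ x v⟩
    rw [← neg_sub]
    exact neg_mem (sub_projField_mem _ x v)
  have hJi (x v) (hv : v ∈ S i x) : J x v ∈ S z x ∧ v + J x v ∈ S o x := by
    have hJv : J x v = B x v - v := by
      change A x (P x v) - P x v + (B x (Q x v) - Q x v) = _
      rw [hPi x v hv, hQi x v hv, map_zero, sub_zero, zero_add]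
    rw [hJv, add_sub_cancel]
    refine ⟨?_, projField_mem _ x v⟩
    rw [← neg_sub]
    exact neg_mem (sub_projField_mem _ x v)
  have hJJz (x v) (hv : v ∈ S z x) : J x (J x v) = v := by
    obtain ⟨h1, h2⟩ := hJz x v hv
    obtain ⟨h3, h4⟩ := hJi x _ h1
    -- Both `v + Jv` and `Jv + JJv` lie in `S o`, so their difference lies in `S o` as well as in `S
    -- z`.
    refine sub_eq_zero.1 (hzero hzo (sub_mem h3 hv) ?_)
    have : J x (J x v) - v = (J x v + J x (J x v)) - (v + J x v) := by abel
    rw [this]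
    exact sub_mem h4 h2
  have hJJi (x v) (hv : v ∈ S i x) : J x (J x v) = v := by
    obtain ⟨h1, h2⟩ := hJi x v hv
    obtain ⟨h3, h4⟩ := hJz x _ h1
    refine sub_eq_zero.1 (hzero hoi.symm (sub_mem h3 hv) ?_)
    have : J x (J x v) - v = (J x v + J x (J x v)) - (v + J x v) := by abel
    rw [this]
    exact sub_mem h4 h2
  refine ⟨P, Q, J, ⟨hP, hQ, hJ, hadd, fun x v ↦ hPz x _ (hPmem x v), fun x v ↦ ?_, fun x v ↦ ?_⟩,
    fun x v ↦ ⟨hQz x v, fun h ↦ ?_⟩, fun x v ↦ ⟨hPi x v, fun h ↦ ?_⟩, fun x v hv ↦ (hJz x v hv).2⟩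
  · have h := congrArg (fun w ↦ Q x (J x w)) (hadd x v)
    simp only [map_add] at h
    rw [← h, hQi x _ (hJz x _ (hPmem x v)).1, hQz x _ (hJi x _ (hQmem x v)).1, add_zero]
  · have h := congrArg (fun w ↦ J x (J x w)) (hadd x v)
    simp only [map_add] at h
    rw [← h, hJJz x _ (hPmem x v), hJJi x _ (hQmem x v), hadd]
  · rw [← hadd x v, h, add_zero]; exact hPmem x v
  · rw [← hadd x v, h, zero_add]; exact hQmem x v

/-- In terms of a splitting, membership in `S t` is a graph condition. -/
lemma IsSL2Web.mem_iff_of_add_smul_mem (hS : IsSL2Web n S) {z o i t : CP1} (hti : t ≠ i)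
    {P Q J : EndField E M} (h : IsSplitting P Q J) (hQ : ∀ x v, v ∈ S z x ↔ Q x v = 0)
    (hP : ∀ x v, v ∈ S i x ↔ P x v = 0) (hJ : ∀ x, ∀ v ∈ S z x, v + J x v ∈ S o x) {l : ℂ}
    (hl : ∀ x, ∀ u ∈ S z x, ∀ v ∈ S i x, u + v ∈ S o x → u + l • v ∈ S t x) (x : M)
    (v : TangentSpace 𝓘(ℂ, E) x) : v ∈ S t x ↔ Q x v = l • J x (P x v) := by
  have h1 : P x v ∈ S z x := (hQ x _).2 (h.Q_P x v)
  have h2 : J x (P x v) ∈ S i x := (hP x _).2 (by rw [h.J_P, h.P_Q])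
  have h3 := hl x _ h1 _ h2 (hJ x _ h1)
  constructor
  · intro hv
    have h4 : Q x v - l • J x (P x v) ∈ S t x := by
      have : Q x v - l • J x (P x v) = v - (P x v + l • J x (P x v)) := by rw [h.Q_apply]; abel
      rw [this]
      exact sub_mem hv h3
    have h5 : Q x v - l • J x (P x v) ∈ S i x :=
      sub_mem ((hP x _).2 (h.P_Q x v)) (Submodule.smul_mem _ _ h2)
    exact sub_eq_zero.1 (Submodule.disjoint_def.1 (hS.isCompl hti x).disjoint _ h4 h5)
  · intro hv
    rw [← h.add_apply x v, hv]
    exact h3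

variable [CompleteSpace E]

omit [FiniteDimensional ℂ E] in
/-- The consequences of the involutivity of four members of a web for brackets of sections of
one of them. -/
lemma IsSL2Web.bracket_relations (hS : IsSL2Web n S) {z o i p : CP1} {P Q J : EndField E M}
    (h : IsSplitting P Q J) (hQ : ∀ x v, v ∈ S z x ↔ Q x v = 0)
    (hP : ∀ x v, v ∈ S i x ↔ P x v = 0) (ho : ∀ x v, v ∈ S o x ↔ Q x v = J x (P x v))
    {l : ℂ} (hl0 : l ≠ 0) (hl1 : l ≠ 1) (hp : ∀ x v, v ∈ S p x ↔ Q x v = l • J x (P x v))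
    {X Y : VField E M} {x : M} (hX : HolomorphicAt X x) (hY : HolomorphicAt Y x)
    (hXP : P.app X = X) (hYP : P.app Y = Y) :
    Q x (mlieBracket 𝓘(ℂ, E) X (J.app Y) x + mlieBracket 𝓘(ℂ, E) (J.app X) Y x) =
        J x (mlieBracket 𝓘(ℂ, E) X Y x) ∧
      J x (P x (mlieBracket 𝓘(ℂ, E) X (J.app Y) x + mlieBracket 𝓘(ℂ, E) (J.app X) Y x)) =
        mlieBracket 𝓘(ℂ, E) (J.app X) (J.app Y) x := by
  have hJX : HolomorphicAt (J.app X) x := (h.holJ x).holomorphicAt hX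
  have hJY : HolomorphicAt (J.app Y) x := (h.holJ x).holomorphicAt hY
  have hinv (t : CP1) {X Y : VField E M} (hX : HolomorphicAt X x) (hY : HolomorphicAt Y x)
      (hXt : ∀ y, X y ∈ S t y) (hYt : ∀ y, Y y ∈ S t y) : mlieBracket 𝓘(ℂ, E) X Y x ∈ S t x := by
    obtain ⟨U, hU, hxU, hXU⟩ := hX.exists_holomorphicOn
    obtain ⟨V, hV, hxV, hYV⟩ := hY.exists_holomorphicOn
    exact hS.involutive t (U ∩ V) (hU.inter hV) X Y (hXU.mono Set.inter_subset_left)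
      (hYV.mono Set.inter_subset_right) (fun y _ ↦ hXt y) (fun y _ ↦ hYt y) x ⟨hxU, hxV⟩
  have hPX {X : VField E M} (hXP : P.app X = X) (y : M) : P y (X y) = X y := congrFun hXP y
  have hQX {X : VField E M} (hXP : P.app X = X) (y : M) : Q y (X y) = 0 := by
    rw [← hPX hXP, h.Q_P]
  have hPJ {X : VField E M} (hXP : P.app X = X) (y : M) : P y (J y (X y)) = 0 := by
    rw [← h.J_Q, hQX hXP, map_zero]
  have hQJ {X : VField E M} (hXP : P.app X = X) (y : M) : Q y (J y (X y)) = J y (X y) := by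
    rw [← h.J_P, hPX hXP]
  set b := mlieBracket 𝓘(ℂ, E) X Y x with hb
  set k := mlieBracket 𝓘(ℂ, E) (J.app X) (J.app Y) x with hk
  set c := mlieBracket 𝓘(ℂ, E) X (J.app Y) x + mlieBracket 𝓘(ℂ, E) (J.app X) Y x with hc
  have hQb : Q x b = 0 := (hQ x _).1 (hinv z hX hY (fun y ↦ (hQ y _).2 (hQX hXP y))
    fun y ↦ (hQ y _).2 (hQX hYP y))
  have hPk : P x k = 0 := (hP x _).1 (hinv i hJX hJY (fun y ↦ (hP y _).2 (hPJ hXP y))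
    fun y ↦ (hP y _).2 (hPJ hYP y))
  have hPb : P x b = b := by simpa [hQb] using h.add_apply x b
  have hQk : Q x k = k := by simpa [hPk] using h.add_apply x k
  -- Involutivity is applied to the sections `X + mJX` and `Y + mJY` of the graph of slope `m`,
  -- whose bracket is `b + m c + m² k`. The slopes 1 and `l` then suffice to separate the
  -- coefficients.
  have key {t : CP1} {m : ℂ} (ht : ∀ x v, v ∈ S t x ↔ Q x v = m • J x (P x v)) :
      m • Q x c + (m * m) • k = m • J x b + (m * m) • J x (P x c) := by
    have hmem {X : VField E M} (hXP : P.app X = X) (y : M) : (X + m • J.app X) y ∈ S t y := by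
      rw [ht]
      change Q y (X y + m • J y (X y)) = m • J y (P y (X y + m • J y (X y)))
      rw [map_add, map_smul, hQX hXP, hQJ hXP, map_add, map_smul, hPX hXP, hPJ hXP, smul_zero,
        add_zero, zero_add]
    have hadd {X : VField E M} (hX : HolomorphicAt X x) : HolomorphicAt (X + m • J.app X) x :=
      hX.add_section ((contMDiffAt_const (c := m)).smul_section ((h.holJ x).holomorphicAt hX))
    have hsm {X : VField E M} (hX : HolomorphicAt X x) : HolomorphicAt (m • X) x :=
      (contMDiffAt_const (c := m)).smul_section hX
    have h1 := (ht x _).1 (hinv t (hadd hX) (hadd hY) (hmem hXP) (hmem hYP))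
    have h2 : mlieBracket 𝓘(ℂ, E) (X + m • J.app X) (Y + m • J.app Y) x =
        b + m • c + (m * m) • k := by
      rw [mlieBracket_add_left hX.diffAt (hsm hJX).diffAt,
        mlieBracket_add_right hY.diffAt (hsm hJY).diffAt,
        mlieBracket_add_right hY.diffAt (hsm hJY).diffAt,
        mlieBracket_const_smul_left hJX.diffAt, mlieBracket_const_smul_left hJX.diffAt,
        mlieBracket_const_smul_right hJY.diffAt, mlieBracket_const_smul_right hJY.diffAt]
      module
    rw [h2] at h1
    simp only [map_add, map_smul, hQb, hPb, hPk, hQk, smul_zero, zero_add, add_zero,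
      smul_add, smul_smul] at h1
    exact h1
  have e1 := key (t := o) (m := 1) (by simpa using ho)
  have e2 := key hp
  simp only [one_smul, mul_one] at e1
  have e3 : Q x c + l • k = J x b + l • J x (P x c) := by
    have := congrArg (fun w ↦ l⁻¹ • w) e2
    simpa only [smul_add, smul_smul, inv_mul_cancel₀ hl0, inv_mul_cancel_left₀ hl0, one_smul]
      using this
  have e4 : (l - 1) • (k - J x (P x c)) = 0 := by
    have h1 : Q x c = J x b + J x (P x c) - k := eq_sub_of_add_eq e1
    rw [h1] at e3
    have h2 : (l - 1) • (k - J x (P x c)) =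
      (J x b + J x (P x c) - k + l • k) - (J x b + l • J x (P x c)) := by module
    rw [h2, e3, sub_self]
  have e5 : k = J x (P x c) :=
    sub_eq_zero.1 ((smul_eq_zero.1 e4).resolve_left (sub_ne_zero.2 hl1))
  refine ⟨?_, e5.symm⟩
  rw [← e5] at e1
  exact add_right_cancel e1

/-- The affine points of the projective line. -/
def affinePoint (c : ℂ) : CP1 :=
  Projectivization.mk ℂ ![1, c] fun h ↦ one_ne_zero (congrFun h 0)

lemma affinePoint_injective : Function.Injective affinePoint := by
  intro a b h
  obtain ⟨u, hu⟩ := (Projectivization.mk_eq_mk_iff ℂ _ _ _ _).1 h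
  have h0 := congrFun hu 0
  have h1 := congrFun hu 1
  simp [Units.smul_def] at h0 h1
  rw [h0] at h1
  simpa using h1.symm

lemma affinePoint_natCast_ne {a b : ℕ} (h : a ≠ b) : affinePoint a ≠ affinePoint b :=
  fun hab ↦ h (Nat.cast_injective (affinePoint_injective hab))

/-- Five points are needed: `z`, `o`, `i` for the splitting, and `p`, `q` for the two relations that
fix the slopes. The slope of `p` also serves as the second one in the torsion computation, while
`i`, of infinite slope, is treated apart. -/
theorem GeneratesWeb.exists_isChernConnection (hS : IsSL2Web n S)
    {Ω : Submodule ℂ (TwoForm E M)} (hΩ : GeneratesWeb Ω S) :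
    ∃ cov : CovariantDerivative 𝓘(ℂ, E) E (TangentSpace 𝓘(ℂ, E) : M → Type _),
      IsChernConnection S cov := by
  let z := affinePoint (0 : ℕ)
  let o := affinePoint (1 : ℕ)
  let i := affinePoint (2 : ℕ)
  let p := affinePoint (3 : ℕ)
  let q := affinePoint (4 : ℕ)
  have hne {a b : ℕ} (h : a ≠ b) := affinePoint_natCast_ne h
  have hzo : z ≠ o := hne (by decide)
  have hzi : z ≠ i := hne (by decide)
  have hoi : o ≠ i := hne (by decide)
  have hpz : p ≠ z := hne (by decide)
  have hpo : p ≠ o := hne (by decide)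
  have hpi : p ≠ i := hne (by decide)
  have hconst {t : CP1} := hΩ.exists_add_smul_mem hS hzo hzi hoi hpz hpo hpi
    (q := q) (hne (by decide)) (hne (by decide)) (hne (by decide)) (hne (by decide)) (t := t)
  obtain ⟨P, Q, J, h, hQ, hP, hJ⟩ := hS.exists_isSplitting hzo hzi hoi
  have ho (x v) : v ∈ S o x ↔ Q x v = (1 : ℂ) • J x (P x v) :=
    hS.mem_iff_of_add_smul_mem hoi h hQ hP hJ (fun x u _ v _ huv ↦ by rwa [one_smul]) x v
  have hgraph {t : CP1} (hti : t ≠ i) : ∃ l : ℂ, ∀ x v, v ∈ S t x ↔ Q x v = l • J x (P x v) := by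
    by_cases htz : t = z
    · exact ⟨0, fun x v ↦ by rw [htz, hQ, zero_smul]⟩
    by_cases hto : t = o
    · exact ⟨1, fun x v ↦ by rw [hto, ho]⟩
    obtain ⟨l, -, -, hl⟩ := hconst htz hto hti
    exact ⟨l, hS.mem_iff_of_add_smul_mem hti h hQ hP hJ hl⟩
  obtain ⟨l, hl0, hl1, hl⟩ := hconst hpz hpo hpi
  have hrel {X Y : VField E M} {x : M} (hX : HolomorphicAt X x) (hY : HolomorphicAt Y x)
      (hXP : P.app X = X) (hYP : P.app Y = Y) :=
    hS.bracket_relations h hQ hP (fun x v ↦ by rw [ho, one_smul]) hl0 hl1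
      (hS.mem_iff_of_add_smul_mem hpi h hQ hP hJ hl) hX hY hXP hYP
  refine ⟨h.connection, h.isHolomorphicConnection,
    h.torsion_eq_zero (fun X Y x hX hY hXP hYP ↦ (hrel hX hY hXP hYP).1)
      (fun X Y x hX hY hXP hYP ↦ (hrel hX hY hXP hYP).2), fun t U hU X hX hXt x hx v ↦ ?_⟩
  by_cases hti : t = i
  · subst hti
    rw [hP]
    exact h.P_connection (Filter.eventually_of_mem (hU.mem_nhds hx) fun y hy ↦
      (hP y _).1 (hXt y hy)) v
  · obtain ⟨l, hl⟩ := hgraph hti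
    rw [hl]
    exact h.Q_connection (hX.holomorphicAt hU hx).diffAt
      (Filter.eventually_of_mem (hU.mem_nhds hx) fun y hy ↦ (hl y _).1 (hXt y hy)) v

end Existence

/-! ### Two-forms and coordinate vector fields in charts -/

section Charts

variable {E : Type*} [NormedAddCommGroup E] [NormedSpace ℂ E]
  {M : Type*} [TopologicalSpace M] [ChartedSpace E M] [IsManifold 𝓘(ℂ, E) ω M]

lemma symmL_trivializationAt_eq_mfderiv {x y : M} (hy : y ∈ (extChartAt 𝓘(ℂ, E) x).source) :
    (trivializationAt E (TangentSpace 𝓘(ℂ, E) : M → Type _) x).symmL ℂ y =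
      mfderiv 𝓘(ℂ, E) 𝓘(ℂ, E) (extChartAt 𝓘(ℂ, E) x).symm (extChartAt 𝓘(ℂ, E) x y) := by
  have : IsManifold 𝓘(ℂ, E) 1 M := IsManifold.of_le (n := ω) (by simp)
  have h := TangentBundle.symmL_trivializationAt (I := 𝓘(ℂ, E)) (x₀ := x) (x := y)
    (by simpa using hy)
  rwa [ModelWithCorners.range_eq_univ, mfderivWithin_univ] at h

/-- The tangent trivialization at `x` is inverse to the differential of the inverse chart, so forms
in charts and vector fields in trivializations use the same coordinates. -/
lemma TwoForm.inChart_apply (η : TwoForm E M) {x : M} {y : E}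
    (hy : y ∈ (extChartAt 𝓘(ℂ, E) x).target) (a b : E) :
    TwoForm.inChart η x y ![a, b] =
      η ((extChartAt 𝓘(ℂ, E) x).symm y)
        ![(trivializationAt E (TangentSpace 𝓘(ℂ, E) : M → Type _) x).symmL ℂ _ a,
          (trivializationAt E (TangentSpace 𝓘(ℂ, E) : M → Type _) x).symmL ℂ _ b] := by
  have h := symmL_trivializationAt_eq_mfderiv ((extChartAt 𝓘(ℂ, E) x).map_target hy)
  rw [(extChartAt 𝓘(ℂ, E) x).right_inv hy] at h
  rw [h, TwoForm.inChart]
  change η _ (_ ∘ _) = _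
  congr 1
  ext i; fin_cases i <;> rfl

lemma TwoForm.apply_eq_inChart (η : TwoForm E M) {x y : M}
    (hy : y ∈ (extChartAt 𝓘(ℂ, E) x).source) (v w : TangentSpace 𝓘(ℂ, E) y) :
    η y ![v, w] = TwoForm.inChart η x (extChartAt 𝓘(ℂ, E) x y)
      ![(trivializationAt E (TangentSpace 𝓘(ℂ, E) : M → Type _) x ⟨y, v⟩).2,
        (trivializationAt E (TangentSpace 𝓘(ℂ, E) : M → Type _) x ⟨y, w⟩).2] := by
  obtain ⟨z, hz, rfl⟩ : ∃ z ∈ (extChartAt 𝓘(ℂ, E) x).target, (extChartAt 𝓘(ℂ, E) x).symm z = y :=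
    ⟨_, (extChartAt 𝓘(ℂ, E) x).map_source hy, (extChartAt 𝓘(ℂ, E) x).left_inv hy⟩
  set t := trivializationAt E (TangentSpace 𝓘(ℂ, E) : M → Type _) x
  have hb : (extChartAt 𝓘(ℂ, E) x).symm z ∈ t.baseSet := by simpa [t] using hy
  rw [(extChartAt 𝓘(ℂ, E) x).right_inv hz, TwoForm.inChart_apply η hz]
  have key (u : TangentSpace 𝓘(ℂ, E) ((extChartAt 𝓘(ℂ, E) x).symm z)) :
      t.symmL ℂ _ (t ⟨_, u⟩).2 = u := by
    rw [t.symmL_apply hb]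
    exact t.symm_apply_apply_mk hb u
  rw [key, key]

omit [IsManifold 𝓘(ℂ, E) ω M] in
lemma TwoForm.IsHolomorphic.differentiableAt {η : TwoForm E M} (hη : TwoForm.IsHolomorphic η)
    (x : M) : DifferentiableAt ℂ (TwoForm.inChart η x) (extChartAt 𝓘(ℂ, E) x x) :=
  ((hη x).differentiableOn (by simp)).differentiableAt (extChartAt_target_mem_nhds x)

lemma TwoForm.IsHolomorphic.mdifferentiableAt_apply {η : TwoForm E M}
    (hη : TwoForm.IsHolomorphic η) {Y Z : VField E M} {x : M} (hY : DiffAt Y x) (hZ : DiffAt Z x) :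
    MDifferentiableAt 𝓘(ℂ, E) 𝓘(ℂ, ℂ) (fun y ↦ η y ![Y y, Z y]) x := by
  set t := trivializationAt E (TangentSpace 𝓘(ℂ, E) : M → Type _) x
  have : IsManifold 𝓘(ℂ, E) 1 M := IsManifold.of_le (n := ω) (by simp)
  have hφ : MDifferentiableAt 𝓘(ℂ, E) 𝓘(ℂ, E) (extChartAt 𝓘(ℂ, E) x) x :=
    mdifferentiableAt_extChartAt (by simp)
  -- The function is the coordinate form evaluated at three differentiable arguments: the chart and
  -- the coordinates of both fields.
  have hK : DifferentiableAt ℂ (fun p : E × E × E ↦ TwoForm.inChart η x p.1 ![p.2.1, p.2.2])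
      (extChartAt 𝓘(ℂ, E) x x, (t ⟨x, Y x⟩).2, (t ⟨x, Z x⟩).2) := by
    have h1 : DifferentiableAt ℂ (fun p : E × E × E ↦
        ContinuousAlternatingMap.toContinuousMultilinearMapCLM ℂ (TwoForm.inChart η x p.1))
        (extChartAt 𝓘(ℂ, E) x x, (t ⟨x, Y x⟩).2, (t ⟨x, Z x⟩).2) :=
      (ContinuousLinearMap.differentiableAt _).comp _
        ((hη.differentiableAt x).comp (f := Prod.fst)
          (extChartAt 𝓘(ℂ, E) x x, (t ⟨x, Y x⟩).2, (t ⟨x, Z x⟩).2) differentiableAt_fst)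
    have h2 : ∀ i : Fin 2, DifferentiableAt ℂ (fun p : E × E × E ↦ (![p.2.1, p.2.2] : Fin 2 → E) i)
        (extChartAt 𝓘(ℂ, E) x x, (t ⟨x, Y x⟩).2, (t ⟨x, Z x⟩).2) := by
      intro i
      fin_cases i
      · exact differentiableAt_snd.fst
      · exact differentiableAt_snd.snd
    exact (h1.hasFDerivAt.continuousMultilinearMap_apply
      fun i ↦ (h2 i).hasFDerivAt).differentiableAt
  have hcomp := MDifferentiableAt.comp
    (f := fun y ↦ (extChartAt 𝓘(ℂ, E) x y, (t ⟨y, Y y⟩).2, (t ⟨y, Z y⟩).2)) x hK.mdifferentiableAt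
    (hφ.prodMk_space (((mdifferentiableAt_section 𝓘(ℂ, E) Y).1 hY).prodMk_space
      ((mdifferentiableAt_section 𝓘(ℂ, E) Z).1 hZ)))
  refine hcomp.congr_of_eventuallyEq ?_
  filter_upwards [extChartAt_source_mem_nhds (I := 𝓘(ℂ, E)) x] with y hy
  exact η.apply_eq_inChart hy _ _

/-- The coordinates of the vector field extending `v` constantly in a chart. -/
lemma trivializationAt_extend {x y : M} (hy : y ∈ (extChartAt 𝓘(ℂ, E) x).source)
    (v : TangentSpace 𝓘(ℂ, E) x) :
    (trivializationAt E (TangentSpace 𝓘(ℂ, E) : M → Type _) x ⟨y, FiberBundle.extend E v y⟩).2 =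
      (trivializationAt E (TangentSpace 𝓘(ℂ, E) : M → Type _) x ⟨x, v⟩).2 := by
  set t := trivializationAt E (TangentSpace 𝓘(ℂ, E) : M → Type _) x
  have hb : y ∈ t.baseSet := by simpa [t] using hy
  change (t ⟨y, t.symm y (t ⟨x, v⟩).2⟩).2 = _
  rw [t.apply_mk_symm hb]

/-- Extended vectors have constant coordinates, so only the coefficients of the form are
differentiated. -/
lemma TwoForm.IsHolomorphic.mvfderiv_extend {η : TwoForm E M} (hη : TwoForm.IsHolomorphic η)
    {x : M} (u v w : TangentSpace 𝓘(ℂ, E) x) :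
    mvfderiv 𝓘(ℂ, E) (fun y ↦ η y ![FiberBundle.extend E v y, FiberBundle.extend E w y]) x u =
      fderiv ℂ (TwoForm.inChart η x) (extChartAt 𝓘(ℂ, E) x x)
        (trivializationAt E (TangentSpace 𝓘(ℂ, E) : M → Type _) x ⟨x, u⟩).2
        ![(trivializationAt E (TangentSpace 𝓘(ℂ, E) : M → Type _) x ⟨x, v⟩).2,
          (trivializationAt E (TangentSpace 𝓘(ℂ, E) : M → Type _) x ⟨x, w⟩).2] := by
  set t := trivializationAt E (TangentSpace 𝓘(ℂ, E) : M → Type _) x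
  have : IsManifold 𝓘(ℂ, E) 1 M := IsManifold.of_le (n := ω) (by simp)
  have hφ : MDifferentiableAt 𝓘(ℂ, E) 𝓘(ℂ, E) (extChartAt 𝓘(ℂ, E) x) x :=
    mdifferentiableAt_extChartAt (by simp)
  have hF := (hη.differentiableAt x).hasFDerivAt.continuousAlternatingMap_apply_const
    ![(t ⟨x, v⟩).2, (t ⟨x, w⟩).2]
  have heq : (fun y ↦ η y ![FiberBundle.extend E v y, FiberBundle.extend E w y]) =ᶠ[𝓝 x]
      (fun z ↦ TwoForm.inChart η x z ![(t ⟨x, v⟩).2, (t ⟨x, w⟩).2]) ∘ extChartAt 𝓘(ℂ, E) x := by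
    filter_upwards [extChartAt_source_mem_nhds (I := 𝓘(ℂ, E)) x] with y hy
    rw [η.apply_eq_inChart hy, trivializationAt_extend hy, trivializationAt_extend hy]
    rfl
  have hu : mfderiv 𝓘(ℂ, E) 𝓘(ℂ, E) (extChartAt 𝓘(ℂ, E) x) x u = (t ⟨x, u⟩).2 := by
    rw [← TangentBundle.continuousLinearMapAt_trivializationAt (by simp)]
    exact congrFun (t.coe_linearMapAt_of_mem (R := ℂ) (FiberBundle.mem_baseSet_trivializationAt' x)) u
  have h := ((hF.hasMFDerivAt.comp x hφ.hasMFDerivAt).congr_of_eventuallyEq heq).mfderiv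
  refine (congrArg (fun L : E →L[ℂ] ℂ ↦ L u) h).trans ?_
  rw [← hu]
  rfl

/-- The cyclic sum of derivatives of a closed form on constant coordinate fields vanishes. -/
lemma TwoForm.IsClosed.mvfderiv_cyclic {η : TwoForm E M} (hη : TwoForm.IsHolomorphic η)
    (hc : TwoForm.IsClosed η) {x : M} (u v w : TangentSpace 𝓘(ℂ, E) x) :
    mvfderiv 𝓘(ℂ, E) (fun y ↦ η y ![FiberBundle.extend E v y, FiberBundle.extend E w y]) x u
    + mvfderiv 𝓘(ℂ, E) (fun y ↦ η y ![FiberBundle.extend E w y, FiberBundle.extend E u y]) x v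
    + mvfderiv 𝓘(ℂ, E) (fun y ↦ η y ![FiberBundle.extend E u y, FiberBundle.extend E v y]) x w
      = 0 := by
  rw [hη.mvfderiv_extend, hη.mvfderiv_extend, hη.mvfderiv_extend]
  set t := trivializationAt E (TangentSpace 𝓘(ℂ, E) : M → Type _) x
  have h := congr($(hc x _ (mem_extChartAt_target x))
    ![(t ⟨x, u⟩).2, (t ⟨x, v⟩).2, (t ⟨x, w⟩).2])
  rw [extDeriv, ContinuousAlternatingMap.alternatizeUncurryFin_apply, Fin.sum_univ_three] at h
  have hsw (f : E [⋀^Fin 2]→L[ℂ] ℂ) (a b : E) : f ![a, b] = -f ![b, a] := by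
    have := f.toAlternatingMap.map_swap ![b, a] (i := 0) (j := 1) (by decide)
    rw [show ![b, a] ∘ Equiv.swap (0 : Fin 2) 1 = ![a, b] by ext i; fin_cases i <;> rfl] at this
    exact this
  have h0 (a b c : E) : Fin.removeNth 0 ![a, b, c] = ![b, c] := by ext i; fin_cases i <;> rfl
  have h1 (a b c : E) : Fin.removeNth 1 ![a, b, c] = ![a, c] := by ext i; fin_cases i <;> rfl
  have h2 (a b c : E) : Fin.removeNth 2 ![a, b, c] = ![a, b] := by ext i; fin_cases i <;> rfl
  rw [h0, h1, h2] at h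
  simp only [Fin.val_zero, Fin.val_one, Fin.val_two, pow_zero, pow_one, one_smul, neg_smul,
    even_two.neg_one_pow, ContinuousAlternatingMap.coe_zero, Pi.zero_apply, Matrix.cons_val] at h
  -- Skewness absorbs the minus sign of the middle term of the exterior derivative.
  rw [hsw (fderiv ℂ (TwoForm.inChart η x) (extChartAt 𝓘(ℂ, E) x x) (t ⟨x, v⟩).2)]
  exact h

/-- Constant coordinate fields commute. -/
lemma mlieBracket_extend {x : M} (v w : TangentSpace 𝓘(ℂ, E) x) :
    VectorField.mlieBracket 𝓘(ℂ, E) (FiberBundle.extend E v : VField E M)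
      (FiberBundle.extend E w) x = 0 := by
  have : IsManifold 𝓘(ℂ, E) 1 M := IsManifold.of_le (n := ω) (by simp)
  set t := trivializationAt E (TangentSpace 𝓘(ℂ, E) : M → Type _) x
  have hconst (v : TangentSpace 𝓘(ℂ, E) x) {z : E} (hz : z ∈ (extChartAt 𝓘(ℂ, E) x).target) :
      VectorField.mpullbackWithin 𝓘(ℂ, E) 𝓘(ℂ, E) (extChartAt 𝓘(ℂ, E) x).symm
        (FiberBundle.extend E v : VField E M) (Set.range 𝓘(ℂ, E)) z = (t ⟨x, v⟩).2 := by
    have hs := (extChartAt 𝓘(ℂ, E) x).map_target hz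
    have h := TangentBundle.symmL_trivializationAt (I := 𝓘(ℂ, E)) (x₀ := x)
      (x := (extChartAt 𝓘(ℂ, E) x).symm z) (by simpa using hs)
    rw [(extChartAt 𝓘(ℂ, E) x).right_inv hz] at h
    have he : (FiberBundle.extend E v : VField E M) ((extChartAt 𝓘(ℂ, E) x).symm z) =
        mfderivWithin 𝓘(ℂ, E) 𝓘(ℂ, E) (extChartAt 𝓘(ℂ, E) x).symm (Set.range 𝓘(ℂ, E)) z
          (t ⟨x, v⟩).2 := by
      rw [← h]
      exact (t.symmL_apply (R := ℂ) (by simpa [t] using hs) _).symm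
    rw [VectorField.mpullbackWithin_apply, he]
    exact (isInvertible_mfderivWithin_extChartAt_symm hz).inverse_apply_eq.2 rfl
  have hev (v : TangentSpace 𝓘(ℂ, E) x) :
      VectorField.mpullbackWithin 𝓘(ℂ, E) 𝓘(ℂ, E) (extChartAt 𝓘(ℂ, E) x).symm
        (FiberBundle.extend E v : VField E M) (Set.range 𝓘(ℂ, E))
        =ᶠ[𝓝[(extChartAt 𝓘(ℂ, E) x).symm ⁻¹' Set.univ ∩ Set.range 𝓘(ℂ, E)]
          (extChartAt 𝓘(ℂ, E) x x)] fun _ ↦ (t ⟨x, v⟩).2 := by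
    filter_upwards [mem_nhdsWithin_of_mem_nhds (extChartAt_target_mem_nhds x)] with z hz
    exact hconst v hz
  rw [← VectorField.mlieBracketWithin_univ, VectorField.mlieBracketWithin_apply,
    (hev v).lieBracketWithin_vectorField_eq (hconst v (mem_extChartAt_target x)) (hev w)
      (hconst w (mem_extChartAt_target x))]
  simp only [VectorField.lieBracketWithin, fderivWithin_fun_const, Pi.zero_apply, zero_apply, sub_zero]
  exact ContinuousLinearMap.map_zero _

end Charts

/-! ### The covariant derivative of a two-form is a tensor -/

section Tensor

variable {E : Type*} [NormedAddCommGroup E] [NormedSpace ℂ E]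
  {M : Type*} [TopologicalSpace M] [ChartedSpace E M] [IsManifold 𝓘(ℂ, E) ω M]
  {cov : CovariantDerivative 𝓘(ℂ, E) E (TangentSpace 𝓘(ℂ, E) : M → Type _)}
  {η : TwoForm E M} {x : M}

lemma covDeriv_swap (Y Z : VField E M) (u : TangentSpace 𝓘(ℂ, E) x) :
    covDeriv cov η Y Z x u = -covDeriv cov η Z Y x u := by
  have h : (fun y ↦ η y ![Y y, Z y]) = -fun y ↦ η y ![Z y, Y y] :=
    funext fun y ↦ η.swap y _ _
  rw [covDeriv, covDeriv, h, mvfderiv_neg, η.swap x (cov Y x u), η.swap x (Y x), _root_.neg_apply]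
  ring

lemma covDeriv_add_vector (Y Z : VField E M) (u v : TangentSpace 𝓘(ℂ, E) x) :
    covDeriv cov η Y Z x (u + v) = covDeriv cov η Y Z x u + covDeriv cov η Y Z x v := by
  simp only [covDeriv, map_add, TwoForm.apply_add_left, TwoForm.apply_add_right]
  ring

lemma covDeriv_add_form {θ : TwoForm E M} (hη : TwoForm.IsHolomorphic η)
    (hθ : TwoForm.IsHolomorphic θ) {Y Z : VField E M} (hY : DiffAt Y x) (hZ : DiffAt Z x)
    (u : TangentSpace 𝓘(ℂ, E) x) :
    covDeriv cov (η + θ) Y Z x u = covDeriv cov η Y Z x u + covDeriv cov θ Y Z x u := by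
  have h : (fun y ↦ (η + θ) y ![Y y, Z y]) =
    (fun y ↦ η y ![Y y, Z y]) + fun y ↦ θ y ![Y y, Z y] := rfl
  rw [covDeriv, h, mvfderiv_add (hη.mdifferentiableAt_apply hY hZ)
    (hθ.mdifferentiableAt_apply hY hZ), _root_.add_apply]
  simp only [covDeriv, Pi.add_apply, ContinuousAlternatingMap.add_apply]
  ring

lemma covDeriv_smul_form (c : ℂ) (hη : TwoForm.IsHolomorphic η)
    {Y Z : VField E M} (hY : DiffAt Y x) (hZ : DiffAt Z x) (u : TangentSpace 𝓘(ℂ, E) x) :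
    covDeriv cov (c • η) Y Z x u = c * covDeriv cov η Y Z x u := by
  have h : (fun y ↦ (c • η) y ![Y y, Z y]) =
    (fun _ ↦ c) * fun y ↦ η y ![Y y, Z y] := rfl
  rw [covDeriv, h, mvfderiv_mul mdifferentiableAt_const (hη.mdifferentiableAt_apply hY hZ)]
  simp only [covDeriv, Pi.smul_apply, ContinuousAlternatingMap.smul_apply, _root_.add_apply,
    _root_.smul_apply, smul_eq_mul, mvfderiv_const, _root_.zero_apply]
  ring

/-- The derivative of `f` in `u(f η(Y, Z))` cancels against the Leibniz term of `∇(fY)`. -/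
lemma tensorialAt_covDeriv (hη : TwoForm.IsHolomorphic η) {Z : VField E M} (hZ : DiffAt Z x)
    (u : TangentSpace 𝓘(ℂ, E) x) :
    TensorialAt 𝓘(ℂ, E) E (fun Y : VField E M ↦ covDeriv cov η Y Z x u) x where
  smul {f Y} hf hY := by
    have h : (fun y ↦ η y ![(f • Y) y, Z y]) = f * fun y ↦ η y ![Y y, Z y] :=
      funext fun y ↦ η.apply_smul_left y _ _ _
    simp only [covDeriv]
    rw [h, mvfderiv_mul hf (hη.mdifferentiableAt_apply hY hZ),
      cov.isCovariantDerivativeOn.leibniz hY hf]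
    simp only [_root_.add_apply, _root_.smul_apply, ContinuousLinearMap.smulRight_apply,
      TwoForm.apply_add_left, TwoForm.apply_smul_left, Pi.smul_apply', smul_eq_mul]
    ring
  add {Y Y'} hY hY' := by
    have h : (fun y ↦ η y ![(Y + Y') y, Z y]) =
        (fun y ↦ η y ![Y y, Z y]) + fun y ↦ η y ![Y' y, Z y] :=
      funext fun y ↦ η.apply_add_left y _ _ _
    simp only [covDeriv]
    rw [h, mvfderiv_add (hη.mdifferentiableAt_apply hY hZ) (hη.mdifferentiableAt_apply hY' hZ),
      cov.isCovariantDerivativeOn.add hY hY']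
    simp only [_root_.add_apply, TwoForm.apply_add_left, Pi.add_apply]
    ring

lemma tensorialAt_covDeriv_right (hη : TwoForm.IsHolomorphic η) {Y : VField E M} (hY : DiffAt Y x)
    (u : TangentSpace 𝓘(ℂ, E) x) :
    TensorialAt 𝓘(ℂ, E) E (fun Z : VField E M ↦ covDeriv cov η Y Z x u) x where
  smul {f Z} hf hZ := by
    rw [covDeriv_swap, (tensorialAt_covDeriv hη hY u).smul hf hZ, covDeriv_swap Y, smul_neg]
  add {Z Z'} hZ hZ' := by
    rw [covDeriv_swap, (tensorialAt_covDeriv hη hY u).add hZ hZ', covDeriv_swap Y,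
      covDeriv_swap Y, neg_add]

variable [FiniteDimensional ℂ E]

variable (cov) in
/-- The covariant derivative of a holomorphic two-form along a tangent vector, as a bilinear form
on the tangent space. -/
def covTensor (hη : TwoForm.IsHolomorphic η) (u : TangentSpace 𝓘(ℂ, E) x) :
    TangentSpace 𝓘(ℂ, E) x →L[ℂ] TangentSpace 𝓘(ℂ, E) x →L[ℂ] ℂ :=
  have : CompleteSpace E := FiniteDimensional.complete ℂ E
  have : IsManifold 𝓘(ℂ, E) 1 M := IsManifold.of_le (n := ω) (by simp)
  TensorialAt.mkHom₂ (fun Y Z : VField E M ↦ covDeriv cov η Y Z x u) x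
    (fun _ hZ ↦ tensorialAt_covDeriv hη hZ u) (fun _ hY ↦ tensorialAt_covDeriv_right hη hY u)

lemma covTensor_apply (hη : TwoForm.IsHolomorphic η) {Y Z : VField E M} (hY : DiffAt Y x)
    (hZ : DiffAt Z x) (u : TangentSpace 𝓘(ℂ, E) x) :
    covTensor cov hη u (Y x) (Z x) = covDeriv cov η Y Z x u :=
  have : CompleteSpace E := FiniteDimensional.complete ℂ E
  have : IsManifold 𝓘(ℂ, E) 1 M := IsManifold.of_le (n := ω) (by simp)
  TensorialAt.mkHom₂_apply _ _ hY hZ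

lemma covTensor_eq_extend (hη : TwoForm.IsHolomorphic η) (u v w : TangentSpace 𝓘(ℂ, E) x) :
    covTensor cov hη u v w =
      covDeriv cov η (FiberBundle.extend E v) (FiberBundle.extend E w) x u := rfl

lemma covTensor_swap (hη : TwoForm.IsHolomorphic η) (u v w : TangentSpace 𝓘(ℂ, E) x) :
    covTensor cov hη u v w = -covTensor cov hη u w v :=
  covDeriv_swap _ _ u

lemma diffAt_extend (v : TangentSpace 𝓘(ℂ, E) x) : DiffAt (FiberBundle.extend E v : VField E M) x :=
  have : CompleteSpace E := FiniteDimensional.complete ℂ E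
  have : IsManifold 𝓘(ℂ, E) 1 M := IsManifold.of_le (n := ω) (by simp)
  FiberBundle.mdifferentiableAt_extend 𝓘(ℂ, E) E v

/-- Bianchi identity for a closed form and a torsion-free connection. -/
lemma covTensor_cyclic [CompleteSpace E] (hcov : cov.torsion = 0) (hη : TwoForm.IsHolomorphic η)
    (hc : TwoForm.IsClosed η) (u v w : TangentSpace 𝓘(ℂ, E) x) :
    covTensor cov hη u v w + covTensor cov hη v w u + covTensor cov hη w u v = 0 := by
  have : IsManifold 𝓘(ℂ, E) 1 M := IsManifold.of_le (n := ω) (by simp)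
  -- Coordinate fields commute, so vanishing torsion makes their covariant derivatives symmetric.
  -- The six connection terms of the cyclic sum then cancel in pairs, leaving the exterior
  -- derivative.
  have hsymm (v w : TangentSpace 𝓘(ℂ, E) x) :
      cov (FiberBundle.extend E w) x v = cov (FiberBundle.extend E v) x w := by
    have h := cov.torsion_eq_zero_iff.1 hcov (diffAt_extend v) (diffAt_extend w)
    rw [mlieBracket_extend, FiberBundle.extend_apply_self, FiberBundle.extend_apply_self] at h
    exact sub_eq_zero.1 h
  have h := hc.mvfderiv_cyclic hη u v w
  simp only [covTensor_eq_extend, covDeriv, FiberBundle.extend_apply_self]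
  rw [hsymm v u, hsymm w v, hsymm u w, η.swap x v, η.swap x w, η.swap x u]
  linear_combination h

/-- If a connection preserves a holomorphic distribution, the covariant derivative of a form
annihilated by it is annihilated by it as well. -/
lemma covTensor_eq_zero_of_mem_null {n : ℕ} (hη : TwoForm.IsHolomorphic η)
    (hD : IsHolomorphicSubbundle n η.null) (hcov : Preserves cov η.null)
    (u : TangentSpace 𝓘(ℂ, E) x) {v : TangentSpace 𝓘(ℂ, E) x} (hv : v ∈ η.null x)
    (w : TangentSpace 𝓘(ℂ, E) x) : covTensor cov hη u v w = 0 := by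
  obtain ⟨U, hU, hxU, Y, hY, hYD, rfl⟩ := hD.exists_section hv
  have h := covTensor_apply (cov := cov) hη (hY.holomorphicAt hU hxU).diffAt (diffAt_extend w) u
  rw [FiberBundle.extend_apply_self] at h
  have h0 : (fun y ↦ η y ![Y y, FiberBundle.extend E w y]) =ᶠ[𝓝 x] fun _ ↦ 0 := by
    filter_upwards [hU.mem_nhds hxU] with y hy using hYD y hy _
  have h1 : mvfderiv 𝓘(ℂ, E) (fun y ↦ η y ![Y y, FiberBundle.extend E w y]) x u = 0 := by
    have hm : HasMFDerivAt 𝓘(ℂ, E) 𝓘(ℂ, ℂ) (fun y ↦ η y ![Y y, FiberBundle.extend E w y]) x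
        (0 : E →L[ℂ] ℂ) := (hasMFDerivAt_const (0 : ℂ) x).congr_of_eventuallyEq h0
    exact congrArg (fun L : E →L[ℂ] ℂ ↦ L u) hm.mfderiv
  have h2 : η x ![cov Y x u, FiberBundle.extend E w x] = 0 := hcov U hU Y hY hYD x hxU u _
  have h3 : η x ![Y x, cov (FiberBundle.extend E w) x u] = 0 := hYD x hxU _
  rw [h, covDeriv, h1, h2, h3]
  simp

end Tensor

/-! ### Parallelism of the trisymplectic structure -/

section Parallel

variable {E : Type*} [NormedAddCommGroup E] [NormedSpace ℂ E] [FiniteDimensional ℂ E]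
  [CompleteSpace E]
  {M : Type*} [TopologicalSpace M] [ChartedSpace E M] [IsManifold 𝓘(ℂ, E) ω M]
  {cov : CovariantDerivative 𝓘(ℂ, E) E (TangentSpace 𝓘(ℂ, E) : M → Type _)}
  {n : ℕ} {S : CP1 → Distribution E M} {Ω : Submodule ℂ (TwoForm E M)}

omit [CompleteSpace E] in
lemma covTensor_lincomb {η₁ η₂ η₃ : TwoForm E M} (h₁ : TwoForm.IsHolomorphic η₁)
    (h₂ : TwoForm.IsHolomorphic η₂) (h₃ : TwoForm.IsHolomorphic η₃) {a b c : ℂ} {θ : TwoForm E M}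
    (hθ : TwoForm.IsHolomorphic θ) (h : θ = a • η₁ + b • η₂ + c • η₃) {x : M}
    (u v w : TangentSpace 𝓘(ℂ, E) x) :
    covTensor cov hθ u v w = a * covTensor cov h₁ u v w + b * covTensor cov h₂ u v w +
      c * covTensor cov h₃ u v w := by
  have hsmul (c : ℂ) {η : TwoForm E M} (hη : TwoForm.IsHolomorphic η) :
    TwoForm.IsHolomorphic (c • η) := fun x ↦ (hη x).const_smul c
  have hadd {η η' : TwoForm E M} (hη : TwoForm.IsHolomorphic η) (hη' : TwoForm.IsHolomorphic η') :
    TwoForm.IsHolomorphic (η + η') := fun x ↦ (hη x).add (hη' x)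
  subst h
  have hv := diffAt_extend v
  have hw := diffAt_extend w
  simp only [covTensor_eq_extend]
  rw [covDeriv_add_form (hadd (hsmul a h₁) (hsmul b h₂)) (hsmul c h₃) hv hw,
    covDeriv_add_form (hsmul a h₁) (hsmul b h₂) hv hw, covDeriv_smul_form a h₁ hv hw,
    covDeriv_smul_form b h₂ hv hw, covDeriv_smul_form c h₃ hv hw]

/-- A Chern connection differentiates the forms of `Ω` to zero along each leaf direction. -/
lemma GeneratesWeb.covTensor_eq_zero (hΩ : GeneratesWeb Ω S) (hS : IsSL2Web n S)
    (hcov : IsChernConnection S cov) {z o i p : CP1} (hzo : z ≠ o) (hzi : z ≠ i) (hoi : o ≠ i)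
    (hpz : p ≠ z) (hpo : p ≠ o) (hpi : p ≠ i) {θ : TwoForm E M} (hθ : θ ∈ Ω) {x : M}
    {u : TangentSpace 𝓘(ℂ, E) x} (hu : u ∈ S z x) (v w : TangentSpace 𝓘(ℂ, E) x) :
    covTensor cov (hΩ.holomorphic θ hθ) u v w = 0 := by
  choose η hηΩ hη using hΩ.generates
  have hhol t := hΩ.holomorphic _ (hηΩ t)
  let B (t : CP1) (u v w : TangentSpace 𝓘(ℂ, E) x) : ℂ := covTensor cov (hhol t) u v w
  have hB (t : CP1) (u : TangentSpace 𝓘(ℂ, E) x) {s : TangentSpace 𝓘(ℂ, E) x} (hs : s ∈ S t x)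
      (w : TangentSpace 𝓘(ℂ, E) x) : B t u s w = 0 := by
    have hD := hS.subbundle t
    have hP := hcov.preserves t
    rw [hη t] at hD hP hs
    exact covTensor_eq_zero_of_mem_null (hhol t) hD hP u hs w
  have hB' (t : CP1) (u v : TangentSpace 𝓘(ℂ, E) x) {s : TangentSpace 𝓘(ℂ, E) x}
      (hs : s ∈ S t x) : B t u v s = 0 := by
    rw [show B t u v s = -B t u s v from covTensor_swap (hhol t) u v s, hB t u hs, neg_zero]
  -- In the cyclic identity the other two terms have `u` as an argument of a form annihilated by `S
  -- z`.
  have hz (v w : TangentSpace 𝓘(ℂ, E) x) : B z u v w = 0 := by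
    have h : B z u v w + B z v w u + B z w u v = 0 :=
      covTensor_cyclic hcov.torsion_free (hhol z) (hΩ.closed _ (hηΩ z)) u v w
    rwa [hB' z v w hu, hB z w hu, add_zero, add_zero] at h
  obtain ⟨a, b, c, habc, -, hb, hc⟩ :=
    hΩ.exists_eq_ne_zero hS hηΩ hη hzo hzi hoi hpz hpo hpi
  have hp (v w : TangentSpace 𝓘(ℂ, E) x) : B p u v w = b * B o u v w + c * B i u v w := by
    have h : B p u v w = a * B z u v w + b * B o u v w + c * B i u v w :=
      covTensor_lincomb (hhol z) (hhol o) (hhol i) (hhol p) habc u v w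
    rw [h, hz, mul_zero, zero_add]
  have hadd (t : CP1) (d : ℂ) (v v' w : TangentSpace 𝓘(ℂ, E) x) :
      d * B t u (v + v') w = d * B t u v w + d * B t u v' w := by
    simp only [B, map_add, _root_.add_apply, mul_add]
  have hadd' (t : CP1) (d : ℂ) (v w w' : TangentSpace 𝓘(ℂ, E) x) :
      d * B t u v (w + w') = d * B t u v w + d * B t u v w' := by
    simp only [B, map_add, mul_add]
  -- The multiples of `B o u` and `B i u` are annihilated by `S o` and `S i`, and their sum `B p u`
  -- by `S p`.
  have hi (v w : TangentSpace 𝓘(ℂ, E) x) : B i u v w = 0 := by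
    refine (mul_eq_zero.1 (apply_eq_zero_of_add (hS.isCompl hoi x) (hS.isCompl hpi.symm x)
      (β₁ := fun v w ↦ b * B o u v w) (β₂ := fun v w ↦ c * B i u v w) (hadd i c) (hadd' i c)
      (fun v s hs ↦ ?_) (fun s hs w ↦ ?_) (fun v s hs ↦ ?_) (fun s hs w ↦ ?_) v w)).resolve_left hc
    · simp only [hB' o u v hs, mul_zero]
    · simp only [hB i u hs w, mul_zero]
    · simp only [hB' i u v hs, mul_zero]
    · exact (hp s w).symm.trans (hB p u hs w)
  have ho (v w : TangentSpace 𝓘(ℂ, E) x) : B o u v w = 0 := by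
    refine (mul_eq_zero.1 (apply_eq_zero_of_add (hS.isCompl hoi.symm x) (hS.isCompl hpo.symm x)
      (β₁ := fun v w ↦ c * B i u v w) (β₂ := fun v w ↦ b * B o u v w) (hadd o b) (hadd' o b)
      (fun v s hs ↦ ?_) (fun s hs w ↦ ?_) (fun v s hs ↦ ?_) (fun s hs w ↦ ?_) v w)).resolve_left hb
    · simp only [hi, mul_zero]
    · simp only [hB o u hs w, mul_zero]
    · simp only [hB' o u v hs, mul_zero]
    · exact (add_comm _ _).trans ((hp s w).symm.trans (hB p u hs w))
  obtain ⟨a, b, c, habc⟩ := hΩ.exists_eq hS hηΩ hη hzo hzi hoi hθ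
  have h : covTensor cov (hΩ.holomorphic θ hθ) u v w =
      a * B z u v w + b * B o u v w + c * B i u v w :=
    covTensor_lincomb (hhol z) (hhol o) (hhol i) (hΩ.holomorphic θ hθ) habc u v w
  rw [h, hz, ho, hi]
  simp

/-- The forms of a trisymplectic structure are parallel for every Chern connection of its web. -/
lemma GeneratesWeb.isParallel (hΩ : GeneratesWeb Ω S) (hS : IsSL2Web n S)
    (hcov : IsChernConnection S cov) {η : TwoForm E M} (hη : η ∈ Ω) : IsParallel cov η := by
  intro U hU Y Z hY hZ x hx u
  have hne {a b : ℕ} (h : a ≠ b) : affinePoint a ≠ affinePoint b := affinePoint_natCast_ne h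
  rw [← covTensor_apply (hΩ.holomorphic η hη) (hY.holomorphicAt hU hx).diffAt
    (hZ.holomorphicAt hU hx).diffAt u]
  -- The direction of differentiation is split along two members of the web, and the previous result
  -- is applied to each with the roles of the first two points exchanged.
  obtain ⟨v, hv, w, hw, rfl⟩ := Submodule.mem_sup.1
    ((hS.isCompl (hne (a := 0) (b := 1) (by decide)) x).sup_eq_top ▸ Submodule.mem_top (x := u))
  have hadd : covTensor cov (hΩ.holomorphic η hη) (v + w) (Y x) (Z x) =
      covTensor cov (hΩ.holomorphic η hη) v (Y x) (Z x) +
        covTensor cov (hΩ.holomorphic η hη) w (Y x) (Z x) := covDeriv_add_vector _ _ v w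
  rw [hadd, hΩ.covTensor_eq_zero hS hcov (hne (a := 0) (b := 1) (by decide))
      (hne (a := 0) (b := 2) (by decide)) (hne (a := 1) (b := 2) (by decide))
      (hne (a := 3) (b := 0) (by decide)) (hne (a := 3) (b := 1) (by decide))
      (hne (a := 3) (b := 2) (by decide)) hη hv,
    hΩ.covTensor_eq_zero hS hcov (hne (a := 1) (b := 0) (by decide))
      (hne (a := 1) (b := 2) (by decide)) (hne (a := 0) (b := 2) (by decide))
      (hne (a := 3) (b := 1) (by decide)) (hne (a := 3) (b := 0) (by decide))
      (hne (a := 3) (b := 2) (by decide)) hη hw, add_zero]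

end Parallel

end SL2Web

end

theorem mainTheorem6 {E : Type*} [NormedAddCommGroup E] [NormedSpace ℂ E] [FiniteDimensional ℂ E]
    [CompleteSpace E] {M : Type*} [TopologicalSpace M] [ChartedSpace E M]
    [IsManifold 𝓘(ℂ, E) ω M] (n : ℕ)
    (S : SL2Web.CP1 → SL2Web.Distribution E M) (hS : SL2Web.IsSL2Web n S)
    (Ω : Submodule ℂ (SL2Web.TwoForm E M)) (hΩ : SL2Web.GeneratesWeb Ω S) :
    (∃ cov : CovariantDerivative 𝓘(ℂ, E) E (TangentSpace 𝓘(ℂ, E) : M → Type _),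
      SL2Web.IsChernConnection S cov) ∧
    ∀ cov : CovariantDerivative 𝓘(ℂ, E) E (TangentSpace 𝓘(ℂ, E) : M → Type _),
      SL2Web.IsChernConnection S cov → ∀ η ∈ Ω, SL2Web.IsParallel cov η := by
  exact ⟨hΩ.exists_isChernConnection hS, fun cov hcov η hη ↦ hΩ.isParallel hS hcov hη⟩
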